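/- Let $R$ be an arbitrary associative ring with unit (not necessarily commutative), and let $A=R[x]/(x^2)$, where the variable $x$ commutes with all elements of $R$. Regard $A$ as a $\mathbb{Z}$-graded ring with $A^0=R$, $A^1=Rx$ and $A^i=0$ otherwise. A graded $A$-module is a left $A$-module $M$ with a decomposition $M=\bigoplus_{i\in\mathbb{Z}}M^i$ into additive subgroups such that $A^iM^j\subseteq M^{i+j}$ for all $i,j$; let $\mathrm{GrMod}(A)$ be the category of graded $A$-modules with the $A$-linear maps $f:M\to N$ satisfying $f(M^i)\subseteq N^i$ for all $i$. Let $\mathrm{Mod}(A)$ and $\mathrm{Mod}(R)$ be the categories of left modules. An object $M$ of an abelian category $\mathcal{C}$ with enough projectives is called Gorenstein projective if there is an acyclic complex $\mathbf{P}=(\cdots\to P_1\to P_0\to P_{-1}\to\cdots)$ of projective objects of $\mathcal{C}$ such that $\mathrm{Hom}_{\mathcal{C}}(\mathbf{P},Q)$ is acyclic for every projective object $Q$ of $\mathcal{C}$ and $M\cong\mathrm{Ker}(P_0\to P_{-1})$. **Theorem 3.1.** Let $M$ be a graded $A$-module. The following are equivalent: 1. $M$ is Gorenstein projective in $\mathrm{GrMod}(A)$.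 2. $M$, with its grading forgotten, is Gorenstein projective in $\mathrm{Mod}(A)$. 3. $M$, regarded as an $R$-module via $R\subset A$, is Gorenstein projective in $\mathrm{Mod}(R)$. -/

import Mathlib

open CategoryTheory CategoryTheory.Limits
open scoped DualNumber

universe v u

/-! ## Gorenstein projective objects -/

/-- A complex `⋯ ⟶ P₁ ⟶ P₀ ⟶ P₋₁ ⟶ ⋯` of projective objects is totally acyclic if it is acyclic
and if `Hom(P, Q)` is acyclic for every projective object `Q`. -/
structure IsTotallyAcyclic {C : Type u} [Category.{v} C] [HasZeroMorphisms C]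
    (P : ChainComplex C ℤ) : Prop where
  projective : ∀ i : ℤ, Projective (P.X i)
  acyclic : P.Acyclic
  /-- Exactness of `Hom(P_{i-1}, Q) ⟶ Hom(P_i, Q) ⟶ Hom(P_{i+1}, Q)`. -/
  hom_exact : ∀ Q : C, Projective Q → ∀ i : ℤ,
    Function.Exact (fun g : P.X (i - 1) ⟶ Q => P.d i (i - 1) ≫ g)
      (fun f : P.X i ⟶ Q => P.d (i + 1) i ≫ f)

/-- An object `M` (of an abelian category) is Gorenstein projective if it is
`Ker (P₀ ⟶ P₋₁)` for some totally acyclic complex `P` of projective objects. -/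
def IsGorensteinProjective {C : Type u} [Category.{v} C] [HasZeroMorphisms C] (M : C) : Prop :=
  ∃ P : ChainComplex C ℤ, IsTotallyAcyclic P ∧
    ∃ (k : M ⟶ P.X 0) (w : k ≫ P.d 0 (-1) = 0), Nonempty (IsLimit (KernelFork.ofι k w))

/-! ## The graded ring `R[x]/(x²)`

`A = R[x]/(x²)`, with `x` commuting with the elements of `R`, is Mathlib's ring `R[ε]` of dual
numbers, which is available for an arbitrary (not necessarily commutative) ring `R`. -/

/-- `R[ε]` is the quotient of the polynomial ring `R[x]` by the ideal generated by `x²`. -/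
theorem dualNumber_isQuotient (R : Type u) [Ring R] :
    ∃ φ : Polynomial R →+* R[ε], (∀ r, φ (Polynomial.C r) = TrivSqZeroExt.inl r) ∧
      φ Polynomial.X = ε ∧ Function.Surjective φ ∧
      ∀ p, φ p = 0 ↔ (Polynomial.X ^ 2 : Polynomial R) ∣ p := by
  let φ : Polynomial R →+* R[ε] := Polynomial.eval₂RingHom' (TrivSqZeroExt.inlHom R R) ε
    (fun a => DualNumber.commute_eps_right _)
  have hC : ∀ r, φ (Polynomial.C r) = TrivSqZeroExt.inl r := fun r => by
    simp [φ, Polynomial.eval₂RingHom']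
  have hX : φ Polynomial.X = ε := by simp [φ, Polynomial.eval₂RingHom']
  have hmk : ∀ p : Polynomial R, ∃ q, p = Polynomial.X ^ 2 * q +
      (Polynomial.C (p.coeff 1) * Polynomial.X + Polynomial.C (p.coeff 0)) := fun p =>
    ⟨p.divX.divX, by
      conv_lhs => rw [← Polynomial.divX_mul_X_add p, ← Polynomial.divX_mul_X_add p.divX]
      rw [Polynomial.X_pow_mul, add_mul, mul_assoc, ← pow_two, Polynomial.coeff_divX,
        add_assoc]⟩
  have hφ : ∀ p : Polynomial R, (φ p).fst = p.coeff 0 ∧ (φ p).snd = p.coeff 1 := fun p => by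
    obtain ⟨q, hq⟩ := hmk p
    rw [hq, map_add, map_add, map_mul, map_mul, map_pow, hX, hC, hC]
    rw [← hq]
    simp
  refine ⟨φ, hC, hX, fun a => ⟨Polynomial.C a.snd * Polynomial.X + Polynomial.C a.fst, ?_⟩,
    fun p => ?_⟩
  · ext <;> simp [hφ]
  · rw [Polynomial.X_pow_dvd_iff, TrivSqZeroExt.ext_iff, (hφ p).1, (hφ p).2]
    constructor
    · rintro ⟨h0, h1⟩ d hd
      interval_cases d <;> assumption
    · exact fun h => ⟨h 0 (by norm_num), h 1 (by norm_num)⟩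

/-- The grading of `A = R[ε]`: `A⁰ = R`, `A¹ = R ε`, and `Aⁱ = 0` otherwise. -/
def dualNumberGrading (R : Type u) [Ring R] (i : ℤ) : AddSubgroup R[ε] :=
  if i = 0 then (TrivSqZeroExt.inlHom R R).toAddMonoidHom.range
  else if i = 1 then (TrivSqZeroExt.inrHom R R).toAddMonoidHom.range
  else ⊥

/-! ## The category of graded modules -/

/-- A graded `A`-module for `A = R[ε]`: a left `A`-module `M` with a decomposition
`M = ⨁ i : ℤ, Mⁱ` into additive subgroups such that `Aⁱ Mʲ ⊆ Mⁱ⁺ʲ`. -/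
structure GrMod (R : Type u) [Ring R] where
  carrier : Type v
  [addCommGroup : AddCommGroup carrier]
  [module : Module R[ε] carrier]
  component : ℤ → AddSubgroup carrier
  isInternal : DirectSum.IsInternal component
  gradedSMul : SetLike.GradedSMul (dualNumberGrading R) component

namespace GrMod

variable {R : Type u} [Ring R]

attribute [instance] GrMod.addCommGroup GrMod.module

/-- Graded maps of degree zero: `A`-linear maps `f` with `f(Mⁱ) ⊆ Nⁱ`. -/
@[ext]
structure Hom (M N : GrMod.{v} R) where
  toLinearMap : M.carrier →ₗ[R[ε]] N.carrier
  map_mem : ∀ (i : ℤ) (x : M.carrier), x ∈ M.component i → toLinearMap x ∈ N.component i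

instance : Category (GrMod.{v} R) where
  Hom M N := Hom M N
  id M := ⟨LinearMap.id, fun _ _ h => h⟩
  comp f g := ⟨g.toLinearMap ∘ₗ f.toLinearMap, fun i _ h => g.map_mem i _ (f.map_mem i _ h)⟩

instance (M N : GrMod.{v} R) : Zero (M ⟶ N) :=
  ⟨Hom.mk 0 fun i _ _ => (N.component i).zero_mem⟩

instance (M N : GrMod.{v} R) : Add (M ⟶ N) :=
  ⟨fun f g => Hom.mk (f.toLinearMap + g.toLinearMap)
    fun i x h => (N.component i).add_mem (f.map_mem i x h) (g.map_mem i x h)⟩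

instance (M N : GrMod.{v} R) : Neg (M ⟶ N) :=
  ⟨fun f => Hom.mk (-f.toLinearMap) fun i x h => (N.component i).neg_mem (f.map_mem i x h)⟩

instance (M N : GrMod.{v} R) : AddCommGroup (M ⟶ N) where
  nsmul := nsmulRec
  zsmul := zsmulRec
  add_assoc _ _ _ := Hom.ext (add_assoc _ _ _)
  zero_add _ := Hom.ext (zero_add _)
  add_zero _ := Hom.ext (add_zero _)
  neg_add_cancel _ := Hom.ext (neg_add_cancel _)
  add_comm _ _ := Hom.ext (add_comm _ _)

instance : Preadditive (GrMod.{v} R) where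
  add_comp _ _ _ _ _ h := Hom.ext (LinearMap.comp_add _ _ h.toLinearMap)
  comp_add _ _ _ f _ _ := Hom.ext (LinearMap.add_comp f.toLinearMap _ _)

/-- The ungraded `A`-module of a graded `A`-module. -/
def toMod (M : GrMod.{v} R) : ModuleCat.{v} R[ε] := ModuleCat.of R[ε] M.carrier

/-- The underlying `R`-module of a graded `A`-module, by restriction along `R → A`. -/
noncomputable def toBaseMod (M : GrMod.{v} R) : ModuleCat.{v} R :=
  (ModuleCat.restrictScalars (TrivSqZeroExt.inlHom R R)).obj M.toMod

end GrMod

/-!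
# Gorenstein projective graded modules over the dual numbers

Write `A = R[ε]`. Both functors `GrMod A ⥤ Mod R` and `Mod A ⥤ Mod R` that restrict scalars are
treated by one argument, `IsFrobeniusLike.isGorensteinProjective_iff`: a faithful exact functor
`U : C ⥤ D` preserves and reflects Gorenstein projective objects if it preserves projectives, if
every projective `N` of `D` has a cofree object `G N` over it which is again projective, and if
every projective of `C` is a direct summand of such a `G N`.

Instead of complexes the proof handles single short exact sequences `0 ⟶ X ⟶ P ⟶ X' ⟶ 0` with `P`
projective such that maps from `X` to projectives extend to `P` (`IsSyzygySequence`). An object is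
Gorenstein projective as soon as it lies in a class of objects that start and end such sequences
within the class (`IsSyzygyStable.isGorensteinProjective`), because the sequences can be spliced.

* `U` preserves Gorenstein projectives since it preserves these sequences: maps `U X ⟶ N` to a
  projective are maps `X ⟶ G N` to a projective.
* `U` reflects them since the class of all `X` for which `U X` is a direct summand of a Gorenstein
  projective plus a projective object (`IsStableRetract`) is syzygy stable. If `U X ⟶ P` is an
  embedding into a projective to which maps into projectives extend, then so is the adjoint map
  `X ⟶ G P`. That the cokernel stays in the class is the comparison of two syzygy sequences, as in
  Schanuel's lemma (`IsStableRetract.cosyzygy`); kernels of maps from projectives onto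
  `X` are handled dually (`IsStableRetract.syzygy`).

For `Mod A` the cofree object on `N` is `N ⊕ N ε`, and `A`-linear maps out of it are `R`-linear maps
out of `N`, so it is projective if `N` is. For `GrMod A` it is the direct sum of all shifts of
`N ⊕ N ε`; in each degree only two copies of `N` occur, so the sum is also the product of the
shifts, which makes it cofree.
-/

/-! ### Syzygy sequences and a coinduction principle -/

section Abstract

universe v₁ v₂ u₁ u₂

variable {C : Type u₁} [Category.{v₁} C] {D : Type u₂} [Category.{v₂} D]

/-- Every morphism from `X` to a projective object extends along `i : X ⟶ Y`. -/
def ExtendsToProjectives {X Y : C} (i : X ⟶ Y) : Prop :=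
  ∀ ⦃Q : C⦄, Projective Q → ∀ f : X ⟶ Q, ∃ g : Y ⟶ Q, i ≫ g = f

/-- A short exact sequence `0 ⟶ X ⟶ P ⟶ X' ⟶ 0` with `P` projective that stays exact under
`Hom(-, Q)` for every projective `Q`. Totally acyclic complexes are spliced from such sequences. -/
structure IsSyzygySequence [HasZeroMorphisms C] (T : ShortComplex C) : Prop where
  shortExact : T.ShortExact
  projective : Projective T.X₂
  extends_f : ExtendsToProjectives T.f

/-- A class of objects each of which starts a syzygy sequence ending in the class and ends a
syzygy sequence starting in the class. -/
def IsSyzygyStable [HasZeroMorphisms C] (S : C → Prop) : Prop :=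
  ∀ X, S X →
    (∃ T : ShortComplex C, IsSyzygySequence T ∧ Nonempty (T.X₁ ≅ X) ∧ S T.X₃) ∧
    (∃ T : ShortComplex C, IsSyzygySequence T ∧ Nonempty (T.X₃ ≅ X) ∧ S T.X₁)

/-- A relation that is total on both sides has a bi-infinite chain through any given point. -/
lemma exists_int_chain {α : Type*} (r : α → α → Prop) (hl : ∀ a, ∃ b, r b a)
    (hr : ∀ a, ∃ b, r a b) (a : α) : ∃ f : ℤ → α, f 0 = a ∧ ∀ i, r (f (i + 1)) (f i) := by
  choose l hl using hl
  choose s hs using hr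
  refine ⟨fun i => match i with
    | Int.ofNat k => l^[k] a
    | Int.negSucc k => s^[k + 1] a, rfl, ?_⟩
  rintro (k | k)
  · change r (l^[k + 1] a) (l^[k] a)
    rw [Function.iterate_succ_apply']
    exact hl _
  · rcases k with _ | k
    · exact hs _
    · have : Int.negSucc (k + 1) + 1 = Int.negSucc k := by omega
      rw [this]
      change r (s^[k + 1] a) (s^[k + 1 + 1] a)
      rw [Function.iterate_succ_apply' s (k + 1)]
      exact hs _

/-- Coinduction for Gorenstein projective objects: the syzygy sequences of a syzygy stable class
can be spliced into totally acyclic complexes. -/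
theorem IsSyzygyStable.isGorensteinProjective [Abelian C] {S : C → Prop} (hS : IsSyzygyStable S)
    {M : C} (hM : S M) : IsGorensteinProjective M := by
  -- The chain is taken in the type of syzygy sequences with both ends in `S` up to isomorphism.
  let α := {T : ShortComplex C // IsSyzygySequence T ∧
    (∃ X, S X ∧ Nonempty (T.X₁ ≅ X)) ∧ (∃ X, S X ∧ Nonempty (T.X₃ ≅ X))}
  obtain ⟨T₀, hT₀, ⟨e₀⟩, hT₀'⟩ := (hS M hM).1
  obtain ⟨T, hT0, hT⟩ := exists_int_chain (fun T T' : α => Nonempty (T.1.X₃ ≅ T'.1.X₁))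
    (fun ⟨T, hT, ⟨X, hX, ⟨e⟩⟩, _⟩ => by
      obtain ⟨T', hT', ⟨e'⟩, h⟩ := (hS X hX).2
      exact ⟨⟨T', hT', ⟨_, h, ⟨Iso.refl _⟩⟩, ⟨X, hX, ⟨e'⟩⟩⟩, ⟨e' ≪≫ e.symm⟩⟩)
    (fun ⟨T, hT, _, ⟨X, hX, ⟨e⟩⟩⟩ => by
      obtain ⟨T', hT', ⟨e'⟩, h⟩ := (hS X hX).1
      exact ⟨⟨T', hT', ⟨X, hX, ⟨e'⟩⟩, ⟨_, h, ⟨Iso.refl _⟩⟩⟩, ⟨e ≪≫ e'.symm⟩⟩)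
    ⟨T₀, hT₀, ⟨M, hM, ⟨e₀⟩⟩, ⟨_, hT₀', ⟨Iso.refl _⟩⟩⟩
  have e : ∀ i, (T (i + 1)).1.X₃ ≅ (T i).1.X₁ := fun i => (hT i).some
  have hs : ∀ i, IsSyzygySequence (T i).1 := fun i => (T i).2.1
  let π : ∀ i, (T (i + 1)).1.X₂ ⟶ (T i).1.X₁ := fun i => (T (i + 1)).1.g ≫ (e i).hom
  have hπ : ∀ i, Epi (π i) := fun i => by
    have := (hs (i + 1)).shortExact.epi_g
    exact epi_comp _ _
  have hf : ∀ i, Mono (T i).1.f := fun i => (hs i).shortExact.mono_f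
  have hfπ : ∀ i, (T (i + 1)).1.f ≫ π i = 0 := fun i => by simp [π]
  let P : ChainComplex C ℤ := ChainComplex.of (fun i => (T i).1.X₂) (fun i => π i ≫ (T i).1.f)
    (fun i => by simp [reassoc_of% hfπ])
  have hd : ∀ i, P.d (i + 1) i = π i ≫ (T i).1.f := fun i => by simp [P, ChainComplex.of]
  -- `P` is spliced from exact sequences, hence exact.
  have hexact : ∀ i, (ShortComplex.mk (P.d (i + 1 + 1) (i + 1)) (P.d (i + 1) i)
      (P.d_comp_d _ _ _)).Exact := fun i => by
    let φ : ShortComplex.mk (P.d (i + 1 + 1) (i + 1)) (P.d (i + 1) i) (P.d_comp_d _ _ _) ⟶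
        (ShortComplex.mk (T (i + 1)).1.f (P.d (i + 1) i)
          (by rw [hd, reassoc_of% (hfπ i), zero_comp])) :=
      { τ₁ := π (i + 1), τ₂ := 𝟙 _, τ₃ := 𝟙 _
        comm₁₂ := by simpa using (hd (i + 1)).symm
        comm₂₃ := by simp }
    let ψ : (T (i + 1)).1 ⟶ (ShortComplex.mk (T (i + 1)).1.f (P.d (i + 1) i)
          (by rw [hd, reassoc_of% (hfπ i), zero_comp])) :=
      { τ₁ := 𝟙 _, τ₂ := 𝟙 _, τ₃ := (e i).hom ≫ (T i).1.f
        comm₁₂ := by simp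
        comm₂₃ := by simpa [π] using hd i }
    have : Epi φ.τ₁ := hπ _
    have : IsIso φ.τ₂ := inferInstanceAs (IsIso (𝟙 _))
    have : Mono φ.τ₃ := inferInstanceAs (Mono (𝟙 _))
    have : Epi ψ.τ₁ := inferInstanceAs (Epi (𝟙 _))
    have : IsIso ψ.τ₂ := inferInstanceAs (IsIso (𝟙 _))
    have : Mono ψ.τ₃ := mono_comp _ _
    rw [ShortComplex.exact_iff_of_epi_of_isIso_of_mono φ,
      ← ShortComplex.exact_iff_of_epi_of_isIso_of_mono ψ]
    exact (hs _).shortExact.exact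
  have hP : IsTotallyAcyclic P :=
    { projective := fun i => (hs i).projective
      acyclic := fun i => by
        obtain ⟨i, rfl⟩ : ∃ j, i = j + 1 := ⟨i - 1, by omega⟩
        exact (P.exactAt_iff' (i + 1 + 1) (i + 1) i (by simp) (by simp)).2 (hexact i)
      hom_exact := fun Q hQ i => by
        obtain ⟨i, rfl⟩ : ∃ j, i = j + 1 := ⟨i - 1, by omega⟩
        rw [show i + 1 - 1 = i by omega]
        intro f
        constructor
        · intro hf0
          have := hπ (i + 1)
          have := (hs (i + 1)).shortExact.epi_g
          have hf0 : (T (i + 1)).1.f ≫ f = 0 := by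
            rw [← cancel_epi (π (i + 1)), comp_zero, ← Category.assoc, ← hd]
            exact hf0
          obtain ⟨g, hg⟩ := (hs i).extends_f hQ
            ((e i).inv ≫ (hs (i + 1)).shortExact.exact.desc f hf0)
          refine ⟨g, ?_⟩
          change P.d (i + 1) i ≫ g = f
          rw [hd, Category.assoc]
          erw [hg]
          simp [π]
        · rintro ⟨g, rfl⟩
          simp }
  refine ⟨P, hP, ?_⟩
  obtain ⟨m, hm, h0⟩ : ∃ m : (T 0).1.X₃ ⟶ P.X (-1), Mono m ∧ P.d 0 (-1) = (T 0).1.g ≫ m := by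
    have h : ∀ i j, j = i + 1 →
        ∃ m : (T j).1.X₃ ⟶ P.X i, Mono m ∧ P.d j i = (T j).1.g ≫ m := by
      rintro i _ rfl
      exact ⟨(e i).hom ≫ (T i).1.f, mono_comp _ _, (hd i).trans (Category.assoc _ _ _)⟩
    exact h (-1) 0 (by norm_num)
  have hT0' : (T 0).1 = T₀ := by rw [hT0]
  obtain ⟨e₀⟩ : Nonempty ((T 0).1.X₁ ≅ M) := by rw [hT0']; exact ⟨e₀⟩
  have := hf 0
  have hw : (e₀.inv ≫ (T 0).1.f) ≫ P.d 0 (-1) = 0 := by rw [h0]; simp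
  refine ⟨e₀.inv ≫ (T 0).1.f, hw, ⟨KernelFork.IsLimit.ofι' _ _ fun {A} k hk => ?_⟩⟩
  have hk' : k ≫ (T 0).1.g = 0 := by
    rw [h0] at hk
    rw [← cancel_mono m, zero_comp, Category.assoc]
    exact hk
  exact ⟨(hs 0).shortExact.exact.lift k hk' ≫ e₀.hom, by simp⟩

/-- The kernels in a totally acyclic complex, in any degree. They are the Gorenstein projective
objects, but this form needs no shifting of complexes. -/
def IsSyzygy [Abelian C] (X : C) : Prop :=
  ∃ (P : ChainComplex C ℤ) (n : ℤ), IsTotallyAcyclic P ∧ Nonempty (kernel (P.d n (n - 1)) ≅ X)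

lemma IsGorensteinProjective.isSyzygy [Abelian C] {X : C} (h : IsGorensteinProjective X) :
    IsSyzygy X := by
  obtain ⟨P, hP, k, w, ⟨hk⟩⟩ := h
  exact ⟨P, 0, hP, ⟨(kernelIsKernel (P.d 0 (-1))).conePointUniqueUpToIso hk⟩⟩

lemma IsTotallyAcyclic.isSyzygySequence [Abelian C] {P : ChainComplex C ℤ}
    (hP : IsTotallyAcyclic P) (n : ℤ) :
    IsSyzygySequence (ShortComplex.mk (kernel.ι (P.d n (n - 1)))
      (kernel.lift (P.d (n - 1) (n - 1 - 1)) (P.d n (n - 1)) (by simp))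
      (by rw [← cancel_mono (kernel.ι _)]; simp)) := by
  have hex : ∀ i, (ShortComplex.mk (P.d i (i - 1)) (P.d (i - 1) (i - 1 - 1))
      (P.d_comp_d _ _ _)).Exact := fun i =>
    (P.exactAt_iff' i (i - 1) (i - 1 - 1) (by simp) (by simp)).1 (hP.acyclic _)
  have hepi : ∀ i, Epi (kernel.lift (P.d (i - 1) (i - 1 - 1)) (P.d i (i - 1)) (by simp)) :=
    fun i => (ShortComplex.exact_iff_epi_kernel_lift _).1 (hex i)
  refine ⟨ShortComplex.ShortExact.mk' ?_ inferInstance (hepi n), hP.projective n, ?_⟩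
  · refine ShortComplex.exact_of_f_is_kernel _ (KernelFork.IsLimit.ofι' _ _ fun {A} k hk => ?_)
    have h : k ≫ P.d n (n - 1) = 0 := by
      have hd := kernel.lift_ι (P.d (n - 1) (n - 1 - 1)) (P.d n (n - 1)) (P.d_comp_d _ _ _)
      exact ((k ≫= hd.symm).trans (Category.assoc _ _ _).symm).trans
        ((hk =≫ kernel.ι _).trans zero_comp)
    exact ⟨kernel.lift _ k h, kernel.lift_ι _ _ _⟩
  · intro Q hQ f
    obtain ⟨n, rfl⟩ : ∃ m, n = m - 1 := ⟨n + 1, by omega⟩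
    have := hepi n
    have hf : P.d (n + 1) n ≫ kernel.lift (P.d (n - 1) (n - 1 - 1)) (P.d n (n - 1)) (by simp) ≫ f
        = 0 := by
      have : P.d (n + 1) n ≫ kernel.lift (P.d (n - 1) (n - 1 - 1)) (P.d n (n - 1)) (by simp)
          = 0 := by
        rw [← cancel_mono (kernel.ι _)]
        simp
      rw [reassoc_of% this, zero_comp]
    obtain ⟨g, hg⟩ := (hP.hom_exact Q hQ n _).1 hf
    refine ⟨g, ?_⟩
    rw [← cancel_epi (kernel.lift (P.d (n - 1) (n - 1 - 1)) (P.d n (n - 1)) _), ← hg]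
    exact kernel.lift_ι_assoc _ _ _ _

/-- The syzygies of totally acyclic complexes form a syzygy stable class. -/
lemma isSyzygyStable_isSyzygy [Abelian C] : IsSyzygyStable (IsSyzygy (C := C)) := by
  rintro X ⟨P, n, hP, ⟨e⟩⟩
  refine ⟨⟨_, hP.isSyzygySequence n, ⟨e⟩, ⟨P, n - 1, hP, ⟨Iso.refl _⟩⟩⟩, ?_⟩
  obtain ⟨n, rfl⟩ : ∃ m, n = m - 1 := ⟨n + 1, by omega⟩
  exact ⟨_, hP.isSyzygySequence n, ⟨e⟩, ⟨P, n, hP, ⟨Iso.refl _⟩⟩⟩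

lemma isGorensteinProjective_iff_isSyzygy [Abelian C] {X : C} :
    IsGorensteinProjective X ↔ IsSyzygy X :=
  ⟨fun h => h.isSyzygy, fun h => isSyzygyStable_isSyzygy.isGorensteinProjective h⟩

/-- A Gorenstein projective object starts a syzygy sequence with Gorenstein projective end, and
ends one with Gorenstein projective start. -/
lemma isSyzygyStable_isGorensteinProjective [Abelian C] :
    IsSyzygyStable (IsGorensteinProjective (C := C)) := by
  have : IsGorensteinProjective (C := C) = IsSyzygy :=
    funext fun X => propext isGorensteinProjective_iff_isSyzygy
  exact this ▸ isSyzygyStable_isSyzygy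

/-! ### Stable retracts of Gorenstein projective objects -/

/-- `X` is a direct summand of the sum of a Gorenstein projective and a projective object, with the
sum avoided: the identity of `X` is the sum of two maps factoring through such objects. -/
def IsStableRetract [Preadditive C] (X : C) : Prop :=
  ∃ (Z P : C) (a : X ⟶ Z) (b : Z ⟶ X) (c : X ⟶ P) (d : P ⟶ X),
    IsGorensteinProjective Z ∧ Projective P ∧ a ≫ b + c ≫ d = 𝟙 X

lemma IsGorensteinProjective.isStableRetract [Abelian C] {X : C} (h : IsGorensteinProjective X) :
    IsStableRetract X :=
  ⟨X, ⊥_ C, 𝟙 X, 𝟙 X, 0, 0, h, ⟨fun f _ _ => ⟨0, initialIsInitial.hom_ext _ _⟩⟩, by simp⟩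

/-- A stable retract of a Gorenstein projective object embeds into a projective object in such a
way that maps to projective objects extend. -/
lemma IsStableRetract.exists_extendsToProjectives [Abelian C] {X : C} (h : IsStableRetract X) :
    ∃ (P : C) (j : X ⟶ P), Projective P ∧ Mono j ∧ ExtendsToProjectives j := by
  obtain ⟨Z, P, a, b, c, d, hZ, hP, h⟩ := h
  obtain ⟨T, hT, ⟨e⟩, -⟩ := (isSyzygyStable_isGorensteinProjective Z hZ).1
  have := hT.projective
  have := hT.shortExact.mono_f
  refine ⟨T.X₂ ⊞ P, biprod.lift (a ≫ e.inv ≫ T.f) c, inferInstance, ?_, ?_⟩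
  · refine Preadditive.mono_of_cancel_zero _ fun {W} t ht => ?_
    have h₁ := ht =≫ biprod.fst
    have h₂ := ht =≫ biprod.snd
    simp only [Category.assoc, biprod.lift_fst, biprod.lift_snd, zero_comp] at h₁ h₂
    have h₃ : t ≫ a = 0 := by
      rw [← cancel_mono (e.inv ≫ T.f)]
      simpa using h₁
    rw [← Category.comp_id t, ← h]
    simp [reassoc_of% h₃, reassoc_of% h₂]
  · intro Q hQ f
    obtain ⟨g, hg⟩ := hT.extends_f hQ (e.hom ≫ b ≫ f)
    refine ⟨biprod.desc g (d ≫ f), ?_⟩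
    rw [biprod.lift_desc, Category.assoc, Category.assoc, hg]
    have := h =≫ f
    simpa using this

/-- Cosyzygies of stable retracts: given two syzygy sequences, one starting in `X` and one in the
Gorenstein projective object `Z`, extend the maps between `X` and `Z` to the projective terms;
the induced maps between the cokernels exhibit the first as a stable retract of the second. -/
lemma IsStableRetract.cosyzygy [Abelian C] {T : ShortComplex C} (h : IsStableRetract T.X₁)
    (hT : IsSyzygySequence T) : IsStableRetract T.X₃ := by
  obtain ⟨Z, P, a, b, c, d, hZ, hP, h⟩ := h
  obtain ⟨T', hT', ⟨e⟩, hZ'⟩ := (isSyzygyStable_isGorensteinProjective Z hZ).1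
  have := hT.shortExact.epi_g
  have := hT'.shortExact.epi_g
  obtain ⟨α, hα⟩ := hT.extends_f hT'.projective (a ≫ e.inv ≫ T'.f)
  obtain ⟨β, hβ⟩ := hT'.extends_f hT.projective (e.hom ≫ b ≫ T.f)
  obtain ⟨γ, hγ⟩ := hT.extends_f hP c
  have hT0 := T.zero
  have hT0' := T'.zero
  have h₀ : T.f ≫ (α ≫ β + γ ≫ d ≫ T.f - 𝟙 _) = 0 := by
    have := h =≫ T.f
    simp [reassoc_of% hα, hβ, reassoc_of% hγ] at this ⊢
    rw [this, sub_self]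
  let δ := hT.shortExact.exact.desc _ h₀
  have hδ : T.g ≫ δ = α ≫ β + γ ≫ d ≫ T.f - 𝟙 _ := hT.shortExact.exact.g_desc _ h₀
  let α' := hT.shortExact.exact.desc (α ≫ T'.g) (by simp [reassoc_of% hα])
  have hα' : T.g ≫ α' = α ≫ T'.g := hT.shortExact.exact.g_desc _ _
  let β' := hT'.shortExact.exact.desc (β ≫ T.g) (by simp [reassoc_of% hβ])
  have hβ' : T'.g ≫ β' = β ≫ T.g := hT'.shortExact.exact.g_desc _ _
  refine ⟨T'.X₃, T.X₂, α', β', -δ, T.g, hZ', hT.projective, ?_⟩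
  rw [← cancel_epi T.g, Preadditive.comp_add, reassoc_of% hα', hβ', Preadditive.neg_comp,
    Preadditive.comp_neg, reassoc_of% hδ]
  simp

/-- Syzygies of stable retracts, by lifting instead of extending. The same maps show that every
extension of a stable retract by a projective object splits. -/
lemma IsStableRetract.syzygy [Abelian C] {T : ShortComplex C} (h : IsStableRetract T.X₃)
    (hT : T.ShortExact) (hproj : Projective T.X₂) :
    IsStableRetract T.X₁ ∧ IsSyzygySequence T := by
  obtain ⟨Z, P, a, b, c, d, hZ, hP, h⟩ := h
  obtain ⟨T', hT', ⟨e⟩, hZ'⟩ := (isSyzygyStable_isGorensteinProjective Z hZ).2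
  have := hT.epi_g
  have := hT'.shortExact.epi_g
  have := hT.mono_f
  have := hT'.shortExact.mono_f
  have := hT'.projective
  let α := Projective.factorThru (T.g ≫ a ≫ e.inv) T'.g
  have hα : α ≫ T'.g = T.g ≫ a ≫ e.inv := Projective.factorThru_comp _ _
  let β := Projective.factorThru (T'.g ≫ e.hom ≫ b) T.g
  have hβ : β ≫ T.g = T'.g ≫ e.hom ≫ b := Projective.factorThru_comp _ _
  let γ := Projective.factorThru d T.g
  have hγ : γ ≫ T.g = d := Projective.factorThru_comp _ _
  have h₀ : (α ≫ β + T.g ≫ c ≫ γ - 𝟙 _) ≫ T.g = 0 := by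
    have := T.g ≫= h
    simp [hβ, hγ, reassoc_of% hα] at this ⊢
    rw [this, sub_self]
  let δ := hT.exact.lift _ h₀
  have hδ : δ ≫ T.f = α ≫ β + T.g ≫ c ≫ γ - 𝟙 _ := hT.exact.lift_f _ h₀
  let α' := hT'.shortExact.exact.lift (T.f ≫ α) (by simp [hα])
  have hα' : α' ≫ T'.f = T.f ≫ α := hT'.shortExact.exact.lift_f _ _
  let β' := hT.exact.lift (T'.f ≫ β) (by simp [hβ])
  have hβ' : β' ≫ T.f = T'.f ≫ β := hT.exact.lift_f _ _
  have key : α' ≫ β' + T.f ≫ (-δ) = 𝟙 _ := by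
    rw [← cancel_mono T.f, Preadditive.add_comp, Category.assoc, hβ', reassoc_of% hα',
      Category.assoc, Preadditive.neg_comp, Preadditive.comp_neg, hδ]
    simp
  refine ⟨⟨T'.X₁, T.X₂, α', β', T.f, -δ, hZ', hproj, key⟩, hT, hproj, fun Q hQ f => ?_⟩
  obtain ⟨g, hg⟩ := hT'.extends_f hQ (β' ≫ f)
  refine ⟨α ≫ g - δ ≫ f, ?_⟩
  have := key =≫ f
  rw [Preadditive.comp_sub, ← reassoc_of% hα', hg]
  simpa [sub_eq_add_neg] using this

/-- The class of stable retracts is syzygy stable, so stable retracts are Gorenstein projective. -/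
lemma IsStableRetract.isGorensteinProjective [Abelian C] [EnoughProjectives C] {X : C}
    (h : IsStableRetract X) : IsGorensteinProjective X := by
  refine IsSyzygyStable.isGorensteinProjective (S := IsStableRetract) (fun X hX => ⟨?_, ?_⟩) h
  · obtain ⟨P, j, hP, hj, hext⟩ := hX.exists_extendsToProjectives
    let T := ShortComplex.mk j (cokernel.π j) (cokernel.condition j)
    have hT : IsSyzygySequence T :=
      ⟨.mk' (ShortComplex.exact_cokernel j) hj inferInstance, hP, hext⟩
    exact ⟨T, hT, ⟨Iso.refl _⟩, hX.cosyzygy (T := T) hT⟩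
  · let T := ShortComplex.mk (kernel.ι (Projective.π X)) (Projective.π X) (kernel.condition _)
    have hT := hX.syzygy (T := T) (.mk' (ShortComplex.exact_kernel _) inferInstance inferInstance)
      (inferInstanceAs (Projective (Projective.over X)))
    exact ⟨T, hT.2, ⟨Iso.refl _⟩, hT.1⟩

/-! ### Functors that behave like restriction along a Frobenius extension -/

/-- `c : U G ⟶ N` is universal among the morphisms from values of `U` to `N`; that is, `G` is the
value at `N` of a right adjoint of `U`. -/
def IsCofreeOn (U : C ⥤ D) {G : C} {N : D} (c : U.obj G ⟶ N) : Prop :=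
  ∀ (X : C) (f : U.obj X ⟶ N), ∃! g : X ⟶ G, U.map g ≫ c = f

/-- A faithful exact functor `U : C ⥤ D` that behaves like the restriction of scalars along a
Frobenius extension: cofree objects on projectives exist and are projective, and these cofree
objects have all projectives of `C` as direct summands. -/
structure IsFrobeniusLike [HasZeroMorphisms C] [HasZeroMorphisms D] (U : C ⥤ D)
    [U.PreservesZeroMorphisms] : Prop where
  map_shortExact : ∀ T : ShortComplex C, T.ShortExact → (T.map U).ShortExact
  map_projective : ∀ P : C, Projective P → Projective (U.obj P)
  exists_cofree : ∀ N : D, Projective N →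
    ∃ (G : C) (c : U.obj G ⟶ N), Projective G ∧ IsCofreeOn U c
  exists_retract : ∀ Q : C, Projective Q →
    ∃ (N : D) (G : C) (c : U.obj G ⟶ N), Projective N ∧ IsCofreeOn U c ∧ Nonempty (Retract Q G)

variable [Abelian C] [Abelian D] {U : C ⥤ D} [U.PreservesZeroMorphisms]

/-- Extension properties with respect to projectives descend along `U`, since maps to a cofree
object are maps from the image under `U`. -/
lemma IsFrobeniusLike.extendsToProjectives_of_map (hU : IsFrobeniusLike U) {X Y : C} {i : X ⟶ Y}
    (hi : ExtendsToProjectives (U.map i)) : ExtendsToProjectives i := by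
  intro Q hQ f
  obtain ⟨N, G, c, hN, hc, ⟨r⟩⟩ := hU.exists_retract Q hQ
  obtain ⟨h, hh⟩ := hi hN (U.map (f ≫ r.i) ≫ c)
  obtain ⟨g, hg, -⟩ := hc Y h
  refine ⟨g ≫ r.r, ?_⟩
  have : i ≫ g = f ≫ r.i := (hc X _).unique (by rw [U.map_comp, Category.assoc, hg, hh]) rfl
  rw [reassoc_of% this, r.retract, Category.comp_id]

lemma IsFrobeniusLike.map_extendsToProjectives (hU : IsFrobeniusLike U) {X Y : C} {i : X ⟶ Y}
    (hi : ExtendsToProjectives i) : ExtendsToProjectives (U.map i) := by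
  intro N hN f
  obtain ⟨G, c, hG, hc⟩ := hU.exists_cofree N hN
  obtain ⟨g, hg, -⟩ := hc X f
  obtain ⟨h, rfl⟩ := hi hG g
  exact ⟨U.map h ≫ c, by rw [← hg, U.map_comp, Category.assoc]⟩

lemma IsFrobeniusLike.map_isSyzygySequence (hU : IsFrobeniusLike U) {T : ShortComplex C}
    (hT : IsSyzygySequence T) : IsSyzygySequence (T.map U) :=
  ⟨hU.map_shortExact T hT.shortExact, hU.map_projective _ hT.projective,
    hU.map_extendsToProjectives hT.extends_f⟩

lemma IsFrobeniusLike.map_isGorensteinProjective (hU : IsFrobeniusLike U) {X : C}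
    (hX : IsGorensteinProjective X) : IsGorensteinProjective (U.obj X) := by
  refine IsSyzygyStable.isGorensteinProjective
    (S := fun Y => ∃ X, IsGorensteinProjective X ∧ Nonempty (U.obj X ≅ Y)) ?_ ⟨X, hX, ⟨Iso.refl _⟩⟩
  rintro Y ⟨X, hX, ⟨e⟩⟩
  obtain ⟨⟨T, hT, ⟨i⟩, h⟩, ⟨T', hT', ⟨i'⟩, h'⟩⟩ := isSyzygyStable_isGorensteinProjective X hX
  exact ⟨⟨T.map U, hU.map_isSyzygySequence hT, ⟨U.mapIso i ≪≫ e⟩, _, h, ⟨Iso.refl _⟩⟩,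
    ⟨T'.map U, hU.map_isSyzygySequence hT', ⟨U.mapIso i' ≪≫ e⟩, _, h', ⟨Iso.refl _⟩⟩⟩

/-- A functor that behaves like a Frobenius extension reflects Gorenstein projectivity: the objects
`X` with `U X` a stable retract form a syzygy stable class. The embedding of such an `X` into a
projective object is adjoint to one of `U X`. -/
lemma IsFrobeniusLike.isGorensteinProjective_of_map [EnoughProjectives C] [EnoughProjectives D]
    [U.Faithful] (hU : IsFrobeniusLike U) {X : C} (hX : IsGorensteinProjective (U.obj X)) :
    IsGorensteinProjective X := by
  refine IsSyzygyStable.isGorensteinProjective (S := fun X => IsStableRetract (U.obj X))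
    (fun X hX => ⟨?_, ?_⟩) hX.isStableRetract
  · obtain ⟨P, j, hP, hj, hext⟩ := hX.exists_extendsToProjectives
    obtain ⟨G, c, hG, hc⟩ := hU.exists_cofree P hP
    obtain ⟨i, rfl, -⟩ := hc X j
    have : Mono (U.map i) := mono_of_mono _ c
    have hi : Mono i := U.mono_of_mono_map this
    have hiU : ExtendsToProjectives (U.map i) := fun Q hQ f => by
      obtain ⟨g, rfl⟩ := hext hQ f
      exact ⟨c ≫ g, (Category.assoc _ _ _).symm⟩
    let T := ShortComplex.mk i (cokernel.π i) (cokernel.condition i)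
    have hT : IsSyzygySequence T := ⟨.mk' (ShortComplex.exact_cokernel i) hi inferInstance, hG,
      hU.extendsToProjectives_of_map hiU⟩
    exact ⟨T, hT, ⟨Iso.refl _⟩, IsStableRetract.cosyzygy (T := T.map U) hX
      (hU.map_isSyzygySequence hT)⟩
  · let T := ShortComplex.mk (kernel.ι (Projective.π X)) (Projective.π X) (kernel.condition _)
    have hT : T.ShortExact := .mk' (ShortComplex.exact_kernel _) inferInstance inferInstance
    have hproj : Projective T.X₂ := inferInstanceAs (Projective (Projective.over X))
    have h := IsStableRetract.syzygy (T := T.map U) hX (hU.map_shortExact T hT)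
      (hU.map_projective _ hproj)
    exact ⟨T, ⟨hT, hproj, hU.extendsToProjectives_of_map h.2.extends_f⟩, ⟨Iso.refl _⟩, h.1⟩

theorem IsFrobeniusLike.isGorensteinProjective_iff [EnoughProjectives C] [EnoughProjectives D]
    [U.Faithful] (hU : IsFrobeniusLike U) (X : C) :
    IsGorensteinProjective X ↔ IsGorensteinProjective (U.obj X) :=
  ⟨hU.map_isGorensteinProjective, hU.isGorensteinProjective_of_map⟩

end Abstract

/-! ### Modules over the dual numbers -/

section DualNumberModule

variable {R : Type u} [Ring R]

/-- An `R`-module with a square-zero endomorphism `e` is an `R[ε]`-module on which `ε` acts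
by `e`. -/
abbrev dualNumberModule {X : Type*} [AddCommGroup X] [Module R X] (e : X →ₗ[R] X)
    (he : ∀ x, e (e x) = 0) : Module R[ε] X where
  smul a x := a.fst • x + a.snd • e x
  one_smul x := by
    change (1 : R[ε]).fst • x + (1 : R[ε]).snd • e x = x
    simp
  mul_smul a b x := by
    change (a * b).fst • x + (a * b).snd • e x =
      a.fst • (b.fst • x + b.snd • e x) + a.snd • e (b.fst • x + b.snd • e x)
    simp [he, add_smul, mul_smul]
    abel
  smul_zero a := by
    change a.fst • (0 : X) + a.snd • e 0 = 0
    simp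
  smul_add a x y := by
    change a.fst • (x + y) + a.snd • e (x + y) = a.fst • x + a.snd • e x + (a.fst • y + a.snd • e y)
    simp only [map_add, smul_add]
    abel
  add_smul a b x := by
    change (a + b).fst • x + (a + b).snd • e x = a.fst • x + a.snd • e x + (b.fst • x + b.snd • e x)
    simp only [TrivSqZeroExt.fst_add, TrivSqZeroExt.snd_add, add_smul]
    abel
  zero_smul x := by
    change (0 : R[ε]).fst • x + (0 : R[ε]).snd • e x = 0
    simp

lemma dualNumber_eq (a : R[ε]) :
    a = TrivSqZeroExt.inl a.fst + TrivSqZeroExt.inl a.snd * ε := by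
  ext <;> simp

/-- An additive map that commutes with the action of `R` and of `ε` is `R[ε]`-linear. -/
def dualNumberLinearMap {X Y : Type*} [AddCommGroup X] [AddCommGroup Y] [Module R[ε] X]
    [Module R[ε] Y] (f : X →+ Y)
    (hr : ∀ (r : R) x, f ((TrivSqZeroExt.inl r : R[ε]) • x) = (TrivSqZeroExt.inl r : R[ε]) • f x)
    (hε : ∀ x, f ((ε : R[ε]) • x) = (ε : R[ε]) • f x) : X →ₗ[R[ε]] Y where
  toFun := f
  map_add' := f.map_add
  map_smul' a x := by
    rw [dualNumber_eq a, add_smul, mul_smul, map_add, hr, hr, hε]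
    simp [add_smul, mul_smul]

lemma eps_smul_eps_smul {X : Type*} [AddCommGroup X] [Module R[ε] X] (x : X) :
    (ε : R[ε]) • (ε : R[ε]) • x = 0 := by
  rw [smul_smul, DualNumber.eps_mul_eps, zero_smul]

lemma eps_smul_inl_smul {X : Type*} [AddCommGroup X] [Module R[ε] X] (r : R) (x : X) :
    (ε : R[ε]) • (TrivSqZeroExt.inl r : R[ε]) • x =
      (TrivSqZeroExt.inl r : R[ε]) • (ε : R[ε]) • x := by
  rw [smul_smul, smul_smul, (DualNumber.commute_eps_left _).eq]

/-- The `R[ε]`-module `N ⊕ N ε` on an `R`-module `N`; it is both induced and coinduced. -/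
def DualNumberExt (N : Type*) : Type _ := N × N

namespace DualNumberExt

variable {N : Type*} [AddCommGroup N] [Module R N]

instance : AddCommGroup (DualNumberExt N) := inferInstanceAs (AddCommGroup (N × N))

instance : Module R[ε] (DualNumberExt N) :=
  letI : Module R (DualNumberExt N) := inferInstanceAs (Module R (N × N))
  dualNumberModule (LinearMap.inr R N N ∘ₗ LinearMap.fst R N N) (fun _ => rfl)

lemma inl_smul (r : R) (x : DualNumberExt N) :
    (TrivSqZeroExt.inl r : R[ε]) • x = (r • x.1, r • x.2) := by
  change r • (show N × N from x) + (0 : R) • ((0, x.1) : N × N) = _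
  rw [zero_smul, add_zero]
  rfl

lemma eps_smul (x : DualNumberExt N) : (ε : R[ε]) • x = ((0, x.1) : N × N) := by
  change (0 : R) • (show N × N from x) + (1 : R) • ((0, x.1) : N × N) = _
  rw [zero_smul, zero_add, one_smul]

/-- The inclusion `N → N ⊕ N ε`. -/
def incl (N : Type*) [AddCommGroup N] : N →+ DualNumberExt N := AddMonoidHom.inl N N

lemma incl_smul (r : R) (n : N) : incl N (r • n) = (TrivSqZeroExt.inl r : R[ε]) • incl N n :=
  (Prod.ext rfl (smul_zero r).symm : ((r • n, 0) : N × N) = (r • n, r • 0)).trans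
    (inl_smul r (incl N n)).symm

variable (R) in
lemma eq_incl_add (x : DualNumberExt N) : x = incl N x.1 + (ε : R[ε]) • incl N x.2 := by
  rw [eps_smul]
  exact Prod.ext (add_zero _).symm (zero_add _).symm

end DualNumberExt

end DualNumberModule

/-! ### Restriction of scalars from the dual numbers -/

section RestrictScalars

variable {R : Type u} [Ring R]

/-- Restriction of scalars along `R → R[ε]`. -/
noncomputable abbrev restrictBase (R : Type u) [Ring R] : ModuleCat.{v} R[ε] ⥤ ModuleCat.{v} R :=
  ModuleCat.restrictScalars (TrivSqZeroExt.inlHom R R)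

/-- An additive map to an `R`-module that is linear over `R ⊆ R[ε]`, as a morphism from the
restriction of scalars. -/
noncomputable def restrictBaseHom {X : ModuleCat.{v} R[ε]} {N : ModuleCat.{v} R} (f : X →+ N)
    (hf : ∀ (r : R) x, f ((TrivSqZeroExt.inl r : R[ε]) • x) = r • f x) :
    (restrictBase R).obj X ⟶ N :=
  @ModuleCat.ofHom R _ ((restrictBase R).obj X) N _ _ _ _
    { toFun := f
      map_add' := f.map_add
      map_smul' := hf }

/-- An additive map from an `R`-module that is linear over `R ⊆ R[ε]`, as a morphism to the
restriction of scalars. -/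
noncomputable def homRestrictBase {X : ModuleCat.{v} R[ε]} {N : ModuleCat.{v} R} (f : N →+ X)
    (hf : ∀ (r : R) x, f (r • x) = (TrivSqZeroExt.inl r : R[ε]) • f x) :
    N ⟶ (restrictBase R).obj X :=
  @ModuleCat.ofHom R _ N ((restrictBase R).obj X) _ _ _ _
    { toFun := f
      map_add' := f.map_add
      map_smul' := hf }

lemma map_inl_smul_of_restrictBase {X : ModuleCat.{v} R[ε]} {N : ModuleCat.{v} R}
    (f : (restrictBase R).obj X ⟶ N) (r : R) (x : X) :
    f.hom ((TrivSqZeroExt.inl r : R[ε]) • x : X) = r • f.hom x :=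
  f.hom.map_smul r x

lemma map_smul_of_to_restrictBase {X : ModuleCat.{v} R[ε]} {N : ModuleCat.{v} R}
    (f : N ⟶ (restrictBase R).obj X) (r : R) (n : N) :
    (f.hom (r • n) : X) = (TrivSqZeroExt.inl r : R[ε]) • (f.hom n : X) :=
  f.hom.map_smul r n

lemma shortExact_restrictBase (T : ShortComplex (ModuleCat.{v} R[ε])) (hT : T.ShortExact) :
    (T.map (restrictBase R)).ShortExact :=
  ModuleCat.shortComplex_shortExact _
    ((ShortComplex.ShortExact.moduleCat_exact_iff_function_exact T).1 hT.exact)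
    hT.moduleCat_injective_f hT.moduleCat_surjective_g

/-- An `R[ε]`-module is projective over `R` if it is additively isomorphic to a projective
`R`-module, compatibly with the action of `R`. -/
lemma projective_restrictBase_obj {X : ModuleCat.{max u v} R[ε]} {P : Type max u v}
    [AddCommGroup P] [Module R P] [Module.Projective R P] (e : P ≃+ X)
    (he : ∀ (r : R) p, e (r • p) = (TrivSqZeroExt.inl r : R[ε]) • e p) :
    Projective ((restrictBase R).obj X) := by
  have : Module.Projective R ((restrictBase R).obj X) :=
    Module.Projective.of_equiv
      ({ e with map_smul' := he } : P ≃ₗ[R] ((restrictBase R).obj X))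
  exact ModuleCat.projective_of_categoryTheory_projective _

/-- The projection `N ⊕ N ε → N` onto the coefficient of `ε`. -/
noncomputable def cofreeCounit (N : ModuleCat.{v} R) :
    (restrictBase R).obj (ModuleCat.of R[ε] (DualNumberExt N)) ⟶ N :=
  restrictBaseHom (X := ModuleCat.of R[ε] (DualNumberExt N))
    { toFun := fun x => (show DualNumberExt N from x).2
      map_zero' := rfl
      map_add' := fun _ _ => rfl }
    (fun r x => congrArg Prod.snd (DualNumberExt.inl_smul r x))

lemma isCofreeOn_cofreeCounit (N : ModuleCat.{v} R) :
    IsCofreeOn (restrictBase R) (cofreeCounit N) := by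
  intro X f
  -- The morphism adjoint to `f` is `x ↦ f (ε x) + f x ε`.
  let g : X →+ DualNumberExt N :=
    { toFun := fun x => (f.hom ((ε : R[ε]) • x : X), f.hom x)
      map_zero' := by
        rw [smul_zero]
        exact Prod.ext (map_zero f.hom) (map_zero f.hom)
      map_add' := fun x y => by
        rw [smul_add]
        exact Prod.ext (map_add f.hom _ _) (map_add f.hom _ _) }
  refine ⟨ModuleCat.ofHom (Y := DualNumberExt N) (dualNumberLinearMap g ?_ ?_), ?_, ?_⟩
  · intro r x
    rw [DualNumberExt.inl_smul]
    refine Prod.ext ?_ (map_inl_smul_of_restrictBase f r x)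
    change f.hom ((ε : R[ε]) • (TrivSqZeroExt.inl r : R[ε]) • x : X) = _
    rw [eps_smul_inl_smul]
    exact map_inl_smul_of_restrictBase f r _
  · intro x
    rw [DualNumberExt.eps_smul]
    refine Prod.ext ?_ rfl
    change f.hom ((ε : R[ε]) • (ε : R[ε]) • x : X) = 0
    rw [eps_smul_eps_smul]
    exact map_zero f.hom
  · rfl
  · rintro h rfl
    ext x
    refine Prod.ext ?_ rfl
    change (h.hom x : DualNumberExt N).1 = (h.hom ((ε : R[ε]) • x) : DualNumberExt N).2
    rw [map_smul]
    exact (congrArg Prod.snd (DualNumberExt.eps_smul (N := N) (h.hom x))).symm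

/-- The `R[ε]`-linear map `N ⊕ N ε → X` that extends an `R`-linear map `N → X`. -/
noncomputable def fromInduced {X : ModuleCat.{v} R[ε]} {N : ModuleCat.{v} R}
    (f : N ⟶ (restrictBase R).obj X) : ModuleCat.of R[ε] (DualNumberExt N) ⟶ X :=
  ModuleCat.ofHom (X := DualNumberExt N) (dualNumberLinearMap
    { toFun := fun n => (f.hom n.1 : X) + (ε : R[ε]) • (f.hom n.2 : X)
      map_zero' := by
        change (f.hom 0 : X) + (ε : R[ε]) • (f.hom 0 : X) = 0
        rw [map_zero]
        exact (zero_add _).trans (smul_zero _)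
      map_add' := fun m n => by
        change (f.hom (m.1 + n.1) : X) + (ε : R[ε]) • (f.hom (m.2 + n.2) : X) = _
        rw [map_add, map_add]
        erw [smul_add]
        exact add_add_add_comm _ _ _ _ }
    (fun r n => by
      rw [DualNumberExt.inl_smul]
      change (f.hom (r • n.1) : X) + (ε : R[ε]) • (f.hom (r • n.2) : X) =
        (TrivSqZeroExt.inl r : R[ε]) • ((f.hom n.1 : X) + (ε : R[ε]) • (f.hom n.2 : X))
      rw [map_smul_of_to_restrictBase, map_smul_of_to_restrictBase, eps_smul_inl_smul, smul_add])
    (fun n => by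
      rw [DualNumberExt.eps_smul]
      change (f.hom 0 : X) + (ε : R[ε]) • (f.hom n.1 : X) =
        (ε : R[ε]) • ((f.hom n.1 : X) + (ε : R[ε]) • (f.hom n.2 : X))
      rw [map_zero, smul_add, eps_smul_eps_smul, add_zero]
      exact zero_add _))

lemma fromInduced_comp {X Y : ModuleCat.{v} R[ε]} {N : ModuleCat.{v} R}
    (f : N ⟶ (restrictBase R).obj X) (g : X ⟶ Y) :
    fromInduced f ≫ g = fromInduced (f ≫ (restrictBase R).map g) := by
  ext n
  change g.hom ((f.hom n.1 : X) + (ε : R[ε]) • (f.hom n.2 : X)) =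
    g.hom (f.hom n.1 : X) + (ε : R[ε]) • g.hom (f.hom n.2 : X)
  exact (map_add g.hom _ _).trans (congrArg (_ + ·) (map_smul g.hom _ _))

lemma exists_fromInduced_eq {X : ModuleCat.{v} R[ε]} {N : ModuleCat.{v} R}
    (g : ModuleCat.of R[ε] (DualNumberExt N) ⟶ X) : ∃ f, fromInduced f = g := by
  let g' : DualNumberExt N →ₗ[R[ε]] X := g.hom
  refine ⟨homRestrictBase (g'.toAddMonoidHom.comp (DualNumberExt.incl N)) (fun r n => ?_), ?_⟩
  · change g' (DualNumberExt.incl N (r • n)) = _ • g' (DualNumberExt.incl N n)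
    rw [DualNumberExt.incl_smul, map_smul]
  · ext n
    change g' (DualNumberExt.incl N n.1) + (ε : R[ε]) • g' (DualNumberExt.incl N n.2) = g' n
    rw [← map_smul, ← map_add]
    exact congrArg g' (DualNumberExt.eq_incl_add R n).symm

lemma projective_dualNumberExt (N : ModuleCat.{v} R) (hN : Projective N) :
    Projective (ModuleCat.of R[ε] (DualNumberExt N)) where
  factors {X Y} f p hp := by
    obtain ⟨f, rfl⟩ := exists_fromInduced_eq f
    have : Epi ((restrictBase R).map p) :=
      (ModuleCat.epi_iff_surjective _).2 ((ModuleCat.epi_iff_surjective p).1 hp)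
    exact ⟨fromInduced (Projective.factorThru f ((restrictBase R).map p)), by
      rw [fromInduced_comp, Projective.factorThru_comp]⟩

/-- Restriction of scalars from the dual numbers is Frobenius-like: every projective `X` is a
direct summand of `N ⊕ N ε`, where `N` is a projective `R`-module that maps onto `X`. -/
lemma isFrobeniusLike_restrictBase (R : Type u) [Ring R] :
    IsFrobeniusLike (restrictBase.{max u v} R) := by
  have hretract : ∀ Q : ModuleCat.{max u v} R[ε], Projective Q → ∃ N : ModuleCat.{max u v} R,
      Projective N ∧ Nonempty (Retract Q (ModuleCat.of R[ε] (DualNumberExt N))) := by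
    intro Q hQ
    let N := Projective.over ((restrictBase R).obj Q)
    let p : N ⟶ (restrictBase R).obj Q := Projective.π _
    have hp : Function.Surjective p.hom := (ModuleCat.epi_iff_surjective p).1 inferInstance
    have : Epi (fromInduced p) := (ModuleCat.epi_iff_surjective _).2 fun x => by
      obtain ⟨n, hn⟩ := hp x
      refine ⟨((n, 0) : DualNumberExt N), ?_⟩
      change (p.hom n : Q) + (ε : R[ε]) • (p.hom 0 : Q) = x
      rw [hn, map_zero]
      exact (congrArg (x + ·) (smul_zero _)).trans (add_zero _)
    exact ⟨N, inferInstance, ⟨⟨Projective.factorThru (𝟙 Q) (fromInduced p), fromInduced p,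
      Projective.factorThru_comp _ _⟩⟩⟩
  refine ⟨shortExact_restrictBase, fun Q hQ => ?_,
    fun N hN => ⟨_, cofreeCounit N, projective_dualNumberExt N hN, isCofreeOn_cofreeCounit N⟩,
    fun Q hQ => ?_⟩
  · obtain ⟨N, hN, ⟨r⟩⟩ := hretract Q hQ
    have : Module.Projective R N := (IsProjective.iff_projective _).2 hN
    have := projective_restrictBase_obj (X := ModuleCat.of R[ε] (DualNumberExt N))
      (AddEquiv.refl (N × N)) (fun r n => (DualNumberExt.inl_smul r n).symm)
    exact (r.map (restrictBase R)).projective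
  · obtain ⟨N, hN, h⟩ := hretract Q hQ
    exact ⟨N, _, cofreeCounit N, hN, isCofreeOn_cofreeCounit N, h⟩

end RestrictScalars

/-! ### Homogeneous components -/

namespace GrMod

variable {R : Type u} [Ring R]

@[simp]
lemma comp_toLinearMap {M N K : GrMod.{v} R} (f : M ⟶ N) (g : N ⟶ K) :
    Hom.toLinearMap (f ≫ g) = g.toLinearMap ∘ₗ f.toLinearMap := rfl

lemma hom_ext {M N : GrMod.{v} R} {f g : M ⟶ N}
    (h : ∀ x, f.toLinearMap x = g.toLinearMap x) : f = g :=
  Hom.ext (LinearMap.ext h)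

/-- The projection of a graded module onto its component of degree `i`, as an endomorphism of
the additive group. -/
noncomputable def proj (M : GrMod.{v} R) (i : ℤ) : M.carrier →+ M.carrier :=
  (M.component i).subtype.comp ((DFinsupp.evalAddMonoidHom i).comp
    (AddEquiv.ofBijective (DirectSum.coeAddMonoidHom M.component) M.isInternal).symm.toAddMonoidHom)

variable (M : GrMod.{v} R)

lemma proj_mem (i : ℤ) (x : M.carrier) : M.proj i x ∈ M.component i := SetLike.coe_mem _

lemma symm_of_mem {i : ℤ} {x : M.carrier} (hx : x ∈ M.component i) :
    (AddEquiv.ofBijective (DirectSum.coeAddMonoidHom M.component) M.isInternal).symm x =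
      DirectSum.of (fun i => M.component i) i ⟨x, hx⟩ := by
  rw [AddEquiv.symm_apply_eq]
  exact (DirectSum.coeAddMonoidHom_of M.component i ⟨x, hx⟩).symm

variable {M}

lemma proj_of_mem {i : ℤ} {x : M.carrier} (hx : x ∈ M.component i) : M.proj i x = x := by
  change ((AddEquiv.ofBijective (DirectSum.coeAddMonoidHom M.component) M.isInternal).symm x i
    : M.carrier) = x
  rw [symm_of_mem M hx, DirectSum.of_eq_same]

lemma proj_of_mem_of_ne {i j : ℤ} {x : M.carrier} (hx : x ∈ M.component j) (h : i ≠ j) :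
    M.proj i x = 0 := by
  change ((AddEquiv.ofBijective (DirectSum.coeAddMonoidHom M.component) M.isInternal).symm x i
    : M.carrier) = 0
  rw [symm_of_mem M hx, DirectSum.of_eq_of_ne _ _ _ h]
  rfl

lemma exists_eq_sum_proj (x : M.carrier) : ∃ s : Finset ℤ, x = ∑ i ∈ s, M.proj i x := by
  classical
  let v := (AddEquiv.ofBijective (DirectSum.coeAddMonoidHom M.component) M.isInternal).symm x
  refine ⟨DFinsupp.support v, ?_⟩
  have h : DirectSum.coeAddMonoidHom M.component v = x :=
    (AddEquiv.ofBijective (DirectSum.coeAddMonoidHom M.component) M.isInternal).apply_symm_apply x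
  conv_lhs => rw [← h]
  exact DirectSum.coeAddMonoidHom_eq_dfinsuppSum M.component v

lemma exists_finset_proj (x : M.carrier) : ∃ s : Finset ℤ, (∀ i ∉ s, M.proj i x = 0) ∧
    ∀ t, s ⊆ t → x = ∑ i ∈ t, M.proj i x := by
  obtain ⟨s, hs⟩ := exists_eq_sum_proj x
  have h : ∀ i ∉ s, M.proj i x = 0 := fun i hi => by
    rw [hs, map_sum]
    exact Finset.sum_eq_zero fun j hj =>
      proj_of_mem_of_ne (M.proj_mem j x) (by rintro rfl; exact hi hj)
  exact ⟨s, h, fun t hst => hs.trans (Finset.sum_subset hst fun i _ hi => h i hi)⟩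

lemma component_induction {p : M.carrier → Prop} (h : ∀ i, ∀ x ∈ M.component i, p x)
    (h0 : p 0) (hadd : ∀ x y, p x → p y → p (x + y)) (x : M.carrier) : p x := by
  obtain ⟨s, hs⟩ := exists_eq_sum_proj x
  rw [hs]
  exact Finset.sum_induction _ p hadd h0 fun i _ => h i _ (M.proj_mem i x)

/-- A family of additive subgroups that has projections with finitely many non-zero values on each
element is a direct sum decomposition. -/
lemma isInternal_of_proj {X : Type v} [AddCommGroup X] (S : ℤ → AddSubgroup X) (p : ℤ → X →+ X)
    (hS : ∀ i, ∀ x ∈ S i, p i x = x) (hne : ∀ i j, ∀ x ∈ S j, i ≠ j → p i x = 0)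
    (hmem : ∀ i x, p i x ∈ S i) (hsum : ∀ x, ∃ s : Finset ℤ, x = ∑ i ∈ s, p i x) :
    DirectSum.IsInternal S := by
  constructor
  · refine (injective_iff_map_eq_zero _).2 fun v hv => ?_
    have h : ∀ i (v : DirectSum ℤ fun i => S i),
        p i (DirectSum.coeAddMonoidHom S v) = (v i : X) := by
      intro i v
      induction v using DirectSum.induction_on with
      | zero => simp
      | of j x =>
        rw [DirectSum.coeAddMonoidHom_of]
        by_cases hij : i = j
        · subst hij
          rw [DirectSum.of_eq_same, hS _ _ x.2]
        · rw [DirectSum.of_eq_of_ne _ _ _ hij, hne i j _ x.2 hij]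
          rfl
      | add x y hx hy => simp [hx, hy]
    ext i
    rw [← h, hv, map_zero]
    rfl
  · intro x
    obtain ⟨s, hs⟩ := hsum x
    refine ⟨∑ i ∈ s, DirectSum.of (fun i => S i) i ⟨p i x, hmem i x⟩, ?_⟩
    rw [map_sum]
    conv_rhs => rw [hs]
    exact Finset.sum_congr rfl fun i _ => DirectSum.coeAddMonoidHom_of S i _

lemma gradedSMul_of_forall {X : Type v} [AddCommGroup X] [Module R[ε] X] (S : ℤ → AddSubgroup X)
    (h0 : ∀ i (r : R), ∀ x ∈ S i, (TrivSqZeroExt.inl r : R[ε]) • x ∈ S i)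
    (h1 : ∀ i, ∀ x ∈ S i, (ε : R[ε]) • x ∈ S (i + 1)) :
    SetLike.GradedSMul (dualNumberGrading R) S where
  smul_mem := by
    intro i j a x ha hx
    rw [vadd_eq_add]
    unfold dualNumberGrading at ha
    split_ifs at ha with hi hi'
    · obtain ⟨r, rfl⟩ := ha
      rw [hi, zero_add]
      exact h0 j r x hx
    · obtain ⟨r, rfl⟩ := ha
      have : (TrivSqZeroExt.inrHom R R) r = TrivSqZeroExt.inl r * (ε : R[ε]) := by ext <;> simp
      change (TrivSqZeroExt.inrHom R R) r • x ∈ _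
      rw [this, mul_smul, hi', add_comm]
      exact h0 _ _ _ (h1 _ _ hx)
    · rw [AddSubgroup.mem_bot.1 ha, zero_smul]
      exact zero_mem _

lemma inl_smul_mem {i : ℤ} {x : M.carrier} (r : R) (hx : x ∈ M.component i) :
    (TrivSqZeroExt.inl r : R[ε]) • x ∈ M.component i := by
  have := M.gradedSMul
  have h : (TrivSqZeroExt.inl r : R[ε]) ∈ dualNumberGrading R 0 := by
    rw [dualNumberGrading, if_pos rfl]
    exact ⟨r, rfl⟩
  simpa using SetLike.GradedSMul.smul_mem (B := M.component) h hx

lemma eps_smul_mem {i : ℤ} {x : M.carrier} (hx : x ∈ M.component i) :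
    (ε : R[ε]) • x ∈ M.component (i + 1) := by
  have := M.gradedSMul
  have h : (ε : R[ε]) ∈ dualNumberGrading R 1 := by
    rw [dualNumberGrading, if_neg one_ne_zero, if_pos rfl]
    exact ⟨1, rfl⟩
  simpa [add_comm] using SetLike.GradedSMul.smul_mem (B := M.component) h hx

lemma proj_inl_smul (i : ℤ) (r : R) (x : M.carrier) :
    M.proj i ((TrivSqZeroExt.inl r : R[ε]) • x) = (TrivSqZeroExt.inl r : R[ε]) • M.proj i x := by
  induction x using component_induction with
  | h j x hx =>
    by_cases hij : i = j
    · subst hij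
      rw [proj_of_mem hx, proj_of_mem (inl_smul_mem r hx)]
    · rw [proj_of_mem_of_ne hx hij, proj_of_mem_of_ne (inl_smul_mem r hx) hij, smul_zero]
  | h0 => simp
  | hadd x y hx hy => simp [hx, hy]

lemma proj_eps_smul (i : ℤ) (x : M.carrier) :
    M.proj (i + 1) ((ε : R[ε]) • x) = (ε : R[ε]) • M.proj i x := by
  induction x using component_induction with
  | h j x hx =>
    by_cases hij : i = j
    · subst hij
      rw [proj_of_mem hx, proj_of_mem (eps_smul_mem hx)]
    · rw [proj_of_mem_of_ne hx hij, proj_of_mem_of_ne (eps_smul_mem hx) (by omega), smul_zero]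
  | h0 => simp
  | hadd x y hx hy => simp [hx, hy]

lemma map_proj {N : GrMod.{v} R} (f : M ⟶ N) (i : ℤ) (x : M.carrier) :
    f.toLinearMap (M.proj i x) = N.proj i (f.toLinearMap x) := by
  induction x using component_induction with
  | h j x hx =>
    by_cases hij : i = j
    · subst hij
      rw [proj_of_mem hx, proj_of_mem (f.map_mem _ _ hx)]
    · rw [proj_of_mem_of_ne hx hij, proj_of_mem_of_ne (f.map_mem _ _ hx) hij, map_zero]
  | h0 => simp
  | hadd x y hx hy => simp [hx, hy]

/-! ### Graded modules form an abelian category -/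

/-- A submodule containing the components of its elements, with the induced grading. -/
def sub (M : GrMod.{v} R) (N : Submodule R[ε] M.carrier) (hN : ∀ i, ∀ x ∈ N, M.proj i x ∈ N) :
    GrMod.{v} R where
  carrier := N
  component i := (M.component i).comap N.subtype.toAddMonoidHom
  isInternal := isInternal_of_proj _
    (fun i => ((M.proj i).comp N.subtype.toAddMonoidHom).codRestrict N fun x => hN i x x.2)
    (fun _ _ hx => Subtype.ext (proj_of_mem hx))
    (fun _ _ _ hx h => Subtype.ext (proj_of_mem_of_ne hx h))
    (fun i x => M.proj_mem i x)
    (fun x => by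
      obtain ⟨s, hs⟩ := exists_eq_sum_proj (x : M.carrier)
      refine ⟨s, Subtype.ext ?_⟩
      rw [AddSubmonoidClass.coe_finsetSum]
      exact hs)
  gradedSMul := gradedSMul_of_forall _ (fun _ r _ hx => inl_smul_mem (M := M) r hx)
    (fun _ _ hx => eps_smul_mem (M := M) hx)

/-- The inclusion of a graded submodule. -/
def subι (M : GrMod.{v} R) (N : Submodule R[ε] M.carrier) (hN : ∀ i, ∀ x ∈ N, M.proj i x ∈ N) :
    M.sub N hN ⟶ M :=
  Hom.mk N.subtype fun _ _ hx => hx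

/-- The quotient by a submodule containing the components of its elements, graded by the images
of the components. -/
def quot (M : GrMod.{v} R) (N : Submodule R[ε] M.carrier) (hN : ∀ i, ∀ x ∈ N, M.proj i x ∈ N) :
    GrMod.{v} R where
  carrier := M.carrier ⧸ N
  component i := (M.component i).map N.mkQ.toAddMonoidHom
  isInternal := isInternal_of_proj _
    (fun i => QuotientAddGroup.map N.toAddSubgroup N.toAddSubgroup (M.proj i) (hN i))
    (fun i x hx => by
      obtain ⟨x, hx, rfl⟩ := hx
      exact congrArg N.mkQ (proj_of_mem hx))
    (fun i j x hx h => by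
      obtain ⟨x, hx, rfl⟩ := hx
      exact (congrArg N.mkQ (proj_of_mem_of_ne hx h)).trans (map_zero N.mkQ))
    (fun i x => by
      obtain ⟨x, rfl⟩ := N.mkQ_surjective x
      exact ⟨M.proj i x, M.proj_mem i x, rfl⟩)
    (fun x => by
      obtain ⟨x, rfl⟩ := N.mkQ_surjective x
      obtain ⟨s, hs⟩ := exists_eq_sum_proj x
      exact ⟨s, (congrArg N.mkQ hs).trans (map_sum N.mkQ _ _)⟩)
  gradedSMul := gradedSMul_of_forall _
    (fun i r x hx => by
      obtain ⟨x, hx, rfl⟩ := hx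
      exact ⟨_, inl_smul_mem r hx, map_smul N.mkQ _ _⟩)
    (fun i x hx => by
      obtain ⟨x, hx, rfl⟩ := hx
      exact ⟨_, eps_smul_mem hx, map_smul N.mkQ _ _⟩)

/-- The projection onto the quotient by a graded submodule. -/
def quotπ (M : GrMod.{v} R) (N : Submodule R[ε] M.carrier) (hN : ∀ i, ∀ x ∈ N, M.proj i x ∈ N) :
    M ⟶ M.quot N hN :=
  Hom.mk N.mkQ fun _ x hx => ⟨x, hx, rfl⟩

/-- The direct sum of two graded modules. -/
def prod (M N : GrMod.{v} R) : GrMod.{v} R where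
  carrier := M.carrier × N.carrier
  component i := (M.component i).prod (N.component i)
  isInternal := isInternal_of_proj _ (fun i => (M.proj i).prodMap (N.proj i))
    (fun _ _ hx => Prod.ext (proj_of_mem hx.1) (proj_of_mem hx.2))
    (fun _ _ _ hx h => Prod.ext (proj_of_mem_of_ne hx.1 h) (proj_of_mem_of_ne hx.2 h))
    (fun i x => ⟨M.proj_mem i x.1, N.proj_mem i x.2⟩)
    (fun x => by
      obtain ⟨s, -, hs⟩ := exists_finset_proj x.1
      obtain ⟨t, -, ht⟩ := exists_finset_proj x.2
      refine ⟨s ∪ t, Prod.ext ?_ ?_⟩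
      · rw [Prod.fst_sum]
        exact hs _ Finset.subset_union_left
      · rw [Prod.snd_sum]
        exact ht _ Finset.subset_union_right)
  gradedSMul := gradedSMul_of_forall _
    (fun _ r _ hx => ⟨inl_smul_mem r hx.1, inl_smul_mem r hx.2⟩)
    (fun _ _ hx => ⟨eps_smul_mem hx.1, eps_smul_mem hx.2⟩)

instance : HasBinaryBiproducts (GrMod.{v} R) where
  has_binary_biproduct M N := .mk
    { bicone :=
        { pt := M.prod N
          fst := Hom.mk (LinearMap.fst _ _ _) fun _ _ hx => hx.1
          snd := Hom.mk (LinearMap.snd _ _ _) fun _ _ hx => hx.2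
          inl := Hom.mk (LinearMap.inl _ _ _) fun _ _ hx => ⟨hx, zero_mem _⟩
          inr := Hom.mk (LinearMap.inr _ _ _) fun _ _ hx => ⟨zero_mem _, hx⟩
          inl_fst := rfl
          inl_snd := rfl
          inr_fst := rfl
          inr_snd := rfl }
      isBilimit := isBinaryBilimitOfTotal _ (hom_ext fun x =>
        Prod.ext (add_zero x.1) (zero_add x.2)) }

instance : HasZeroObject (GrMod.{v} R) := by
  let Z : GrMod.{v} R :=
    { carrier := PUnit
      component := fun _ => ⊥
      isInternal := isInternal_of_proj _ (fun _ => 0) (fun _ _ _ => rfl) (fun _ _ _ _ _ => rfl)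
        (fun _ _ => rfl) (fun _ => ⟨∅, rfl⟩)
      gradedSMul := gradedSMul_of_forall _ (fun _ _ _ _ => rfl) (fun _ _ _ => rfl) }
  exact ⟨Z, (IsZero.iff_id_eq_zero Z).2 (hom_ext fun _ => rfl)⟩

lemma mono_of_injective {M N : GrMod.{v} R} (f : M ⟶ N) (hf : Function.Injective f.toLinearMap) :
    Mono f where
  right_cancellation _ _ e := hom_ext fun x =>
    hf (LinearMap.congr_fun (congrArg Hom.toLinearMap e) x)

lemma epi_of_surjective {M N : GrMod.{v} R} (f : M ⟶ N)
    (hf : Function.Surjective f.toLinearMap) : Epi f where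
  left_cancellation _ _ e := hom_ext fun x => by
    obtain ⟨x, rfl⟩ := hf x
    exact LinearMap.congr_fun (congrArg Hom.toLinearMap e) x

/-- An injective graded map onto the kernel of `g` is a kernel of `g`. -/
noncomputable def isLimitOfExact {K M N : GrMod.{v} R} (f : K ⟶ M) (g : M ⟶ N)
    (w : f ≫ g = 0) (hf : Function.Injective f.toLinearMap)
    (hfg : ∀ x, g.toLinearMap x = 0 → ∃ y, f.toLinearMap y = x) :
    IsLimit (KernelFork.ofι f w) := by
  have := mono_of_injective f hf
  refine KernelFork.IsLimit.ofι' f w fun {W} k hk => ?_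
  have hk' : ∀ x, k.toLinearMap x ∈ LinearMap.range f.toLinearMap := fun x =>
    hfg _ (LinearMap.congr_fun (congrArg Hom.toLinearMap hk) x)
  let l : W.carrier →ₗ[R[ε]] K.carrier :=
    (LinearEquiv.ofInjective _ hf).symm.toLinearMap ∘ₗ k.toLinearMap.codRestrict _ hk'
  have hl : ∀ x, f.toLinearMap (l x) = k.toLinearMap x := fun x =>
    congrArg Subtype.val ((LinearEquiv.ofInjective _ hf).apply_symm_apply ⟨_, hk' x⟩)
  refine ⟨Hom.mk l fun i x hx => ?_, hom_ext hl⟩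
  have : K.proj i (l x) = l x := hf (by rw [map_proj, hl, proj_of_mem (k.map_mem _ _ hx)])
  exact this ▸ K.proj_mem i _

/-- A surjective graded map whose kernel is the range of `f` is a cokernel of `f`. -/
noncomputable def isColimitOfExact {M N K : GrMod.{v} R} (f : M ⟶ N) (g : N ⟶ K)
    (w : f ≫ g = 0) (hg : Function.Surjective g.toLinearMap)
    (hfg : ∀ x, g.toLinearMap x = 0 → ∃ y, f.toLinearMap y = x) :
    IsColimit (CokernelCofork.ofπ g w) := by
  have := epi_of_surjective g hg
  refine CokernelCofork.IsColimit.ofπ' g w fun {W} k hk => ?_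
  have hk' : LinearMap.ker g.toLinearMap ≤ LinearMap.ker k.toLinearMap := fun x hx => by
    obtain ⟨y, rfl⟩ := hfg x hx
    exact LinearMap.congr_fun (congrArg Hom.toLinearMap hk) y
  let l : K.carrier →ₗ[R[ε]] W.carrier :=
    (LinearMap.ker g.toLinearMap).liftQ k.toLinearMap hk' ∘ₗ
      (g.toLinearMap.quotKerEquivOfSurjective hg).symm.toLinearMap
  have hl : ∀ x, l (g.toLinearMap x) = k.toLinearMap x := fun x => by
    have : (g.toLinearMap.quotKerEquivOfSurjective hg).symm (g.toLinearMap x) =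
        Submodule.Quotient.mk x := by
      rw [LinearEquiv.symm_apply_eq]
      rfl
    change (LinearMap.ker g.toLinearMap).liftQ k.toLinearMap hk'
      ((g.toLinearMap.quotKerEquivOfSurjective hg).symm (g.toLinearMap x)) = _
    rw [this]
    rfl
  refine ⟨Hom.mk l fun i x hx => ?_, hom_ext hl⟩
  obtain ⟨y, rfl⟩ := hg x
  rw [← proj_of_mem hx, ← map_proj, hl]
  exact map_proj k i y ▸ W.proj_mem i _

lemma proj_mem_ker {M N : GrMod.{v} R} (f : M ⟶ N) (i : ℤ) (x : M.carrier)
    (hx : x ∈ LinearMap.ker f.toLinearMap) : M.proj i x ∈ LinearMap.ker f.toLinearMap := by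
  rw [LinearMap.mem_ker] at hx ⊢
  rw [map_proj, hx, map_zero]

lemma proj_mem_range {M N : GrMod.{v} R} (f : M ⟶ N) (i : ℤ) (x : N.carrier)
    (hx : x ∈ LinearMap.range f.toLinearMap) : N.proj i x ∈ LinearMap.range f.toLinearMap := by
  obtain ⟨y, rfl⟩ := hx
  exact ⟨M.proj i y, map_proj f i y⟩

/-- The inclusion of the kernel of a graded map. -/
abbrev kerι {M N : GrMod.{v} R} (f : M ⟶ N) : M.sub _ (proj_mem_ker f) ⟶ M := M.subι _ _

lemma kerι_comp {M N : GrMod.{v} R} (f : M ⟶ N) : kerι f ≫ f = 0 := hom_ext fun x => x.2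

/-- The projection onto the cokernel of a graded map. -/
abbrev cokerπ {M N : GrMod.{v} R} (f : M ⟶ N) : N ⟶ N.quot _ (proj_mem_range f) := N.quotπ _ _

lemma comp_cokerπ {M N : GrMod.{v} R} (f : M ⟶ N) : f ≫ cokerπ f = 0 :=
  hom_ext fun x => (Submodule.Quotient.mk_eq_zero _).2 ⟨x, rfl⟩

lemma injective_of_mono {M N : GrMod.{v} R} (f : M ⟶ N) [Mono f] :
    Function.Injective f.toLinearMap := by
  have h : kerι f = 0 := by rw [← cancel_mono f, kerι_comp, zero_comp]
  refine (injective_iff_map_eq_zero _).2 fun x hx => ?_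
  exact LinearMap.congr_fun (congrArg Hom.toLinearMap h) ⟨x, hx⟩

lemma surjective_of_epi {M N : GrMod.{v} R} (f : M ⟶ N) [Epi f] :
    Function.Surjective f.toLinearMap := by
  have h : cokerπ f = 0 := by rw [← cancel_epi f, comp_cokerπ, comp_zero]
  intro x
  exact (Submodule.Quotient.mk_eq_zero _).1 (LinearMap.congr_fun (congrArg Hom.toLinearMap h) x)

/-- Kernels and cokernels are computed on underlying modules, and a map is mono or epi if and only
if it is injective or surjective. -/
noncomputable instance : Abelian (GrMod.{v} R) where
  has_finite_products := hasFiniteProducts_of_has_binary_and_terminal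
  has_kernels := ⟨fun f => ⟨⟨_, isLimitOfExact (kerι f) f (kerι_comp f) Subtype.val_injective
    fun x hx => ⟨⟨x, hx⟩, rfl⟩⟩⟩⟩
  has_cokernels := ⟨fun f => ⟨⟨_, isColimitOfExact f (cokerπ f) (comp_cokerπ f)
    (Submodule.mkQ_surjective _) fun _ hx => (Submodule.Quotient.mk_eq_zero _).1 hx⟩⟩⟩
  normalMonoOfMono f _ := ⟨{
    Z := _
    g := cokerπ f
    w := comp_cokerπ f
    isLimit := isLimitOfExact f (cokerπ f) (comp_cokerπ f) (injective_of_mono f)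
      fun _ hx => (Submodule.Quotient.mk_eq_zero _).1 hx }⟩
  normalEpiOfEpi f _ := ⟨{
    W := _
    g := kerι f
    w := kerι_comp f
    isColimit := isColimitOfExact (kerι f) f (kerι_comp f) (surjective_of_epi f)
      fun x hx => ⟨⟨x, hx⟩, rfl⟩ }⟩

/-- The functor forgetting the grading. -/
def forgetGrading (R : Type u) [Ring R] : GrMod.{v} R ⥤ ModuleCat.{v} R[ε] where
  obj M := M.toMod
  map f := ModuleCat.ofHom f.toLinearMap

instance : (forgetGrading.{v} R).PreservesZeroMorphisms where
  map_zero _ _ := rfl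

instance : (forgetGrading.{v} R).Faithful where
  map_injective h := Hom.ext (congrArg ModuleCat.Hom.hom h)

lemma shortExact_forgetGrading (T : ShortComplex (GrMod.{v} R)) (hT : T.ShortExact) :
    (T.map (forgetGrading R)).ShortExact := by
  have := hT.mono_f
  have := hT.epi_g
  refine ModuleCat.shortComplex_shortExact _ (fun x => ⟨fun hx => ?_, ?_⟩)
    (injective_of_mono T.f) (surjective_of_epi T.g)
  · -- An element of the kernel of `T.g` is found in the image of `T.f` by lifting the inclusion
    -- of the kernel.
    have h := hT.exact.lift_f (kerι T.g) (kerι_comp T.g)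
    exact ⟨_, LinearMap.congr_fun (congrArg Hom.toLinearMap h) ⟨x, hx⟩⟩
  · rintro ⟨y, rfl⟩
    exact LinearMap.congr_fun (congrArg Hom.toLinearMap T.zero) y

/-! ### The graded module induced from a base module -/

/-- The projections of a graded module are determined by their values on homogeneous elements. -/
lemma proj_eq_of_forall {M : GrMod.{v} R} (i : ℤ) (p : M.carrier →+ M.carrier)
    (hp : ∀ x ∈ M.component i, p x = x) (hne : ∀ j, i ≠ j → ∀ x ∈ M.component j, p x = 0)
    (x : M.carrier) : M.proj i x = p x := by
  induction x using component_induction with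
  | h j x hx =>
    by_cases hij : i = j
    · subst hij
      rw [proj_of_mem hx, hp x hx]
    · rw [proj_of_mem_of_ne hx hij, hne j hij x hx]
  | h0 => simp
  | hadd x y hx hy => simp [hx, hy]

/-- The sum over all `j : ℤ` of the shifts `(N ⊕ N ε)(-j)`: its component of degree `j` consists of
the functions supported at `j`. The pair `(a, b)` at `j` stands for `a` in the shift by `j` plus
`b ε` in the shift by `j - 1`, so `ε` sends it to `(0, a)` at `j + 1`. -/
def GradedExt (N : Type v) [AddCommGroup N] : Type v := ℤ →₀ N × N

namespace GradedExt

variable {N : Type v} [AddCommGroup N] [Module R N]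

noncomputable instance : AddCommGroup (GradedExt N) := inferInstanceAs (AddCommGroup (ℤ →₀ N × N))

instance : FunLike (GradedExt N) ℤ (N × N) := inferInstanceAs (FunLike (ℤ →₀ N × N) ℤ (N × N))

variable (R) in
/-- The square-zero endomorphism by which `ε` acts. -/
noncomputable def epsMap (N : Type v) [AddCommGroup N] [Module R N] :
    (ℤ →₀ N × N) →ₗ[R] (ℤ →₀ N × N) :=
  (Finsupp.domLCongr (Equiv.addRight (1 : ℤ))).toLinearMap ∘ₗ
    Finsupp.mapRange.linearMap (LinearMap.inr R N N ∘ₗ LinearMap.fst R N N)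

lemma epsMap_apply (x : ℤ →₀ N × N) (j : ℤ) : epsMap R N x j = (0, (x (j - 1)).1) := by
  simp [epsMap, Finsupp.domLCongr_apply, Finsupp.equivMapDomain_apply, sub_eq_add_neg]

noncomputable instance : Module R[ε] (GradedExt N) :=
  letI : Module R (GradedExt N) := inferInstanceAs (Module R (ℤ →₀ N × N))
  dualNumberModule (X := ℤ →₀ N × N) (epsMap R N) fun x => by
    ext j <;> simp [epsMap_apply]

lemma ext {x y : GradedExt N} (h : ∀ j, x j = y j) : x = y := Finsupp.ext h

@[simp]
lemma add_apply (x y : GradedExt N) (j : ℤ) : (x + y) j = x j + y j := Finsupp.add_apply _ _ _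

@[simp]
lemma inl_smul_apply (r : R) (x : GradedExt N) (j : ℤ) :
    ((TrivSqZeroExt.inl r : R[ε]) • x) j = r • x j := by
  change (r • (show ℤ →₀ N × N from x) + (0 : R) • epsMap R N x) j = _
  rw [zero_smul, add_zero]
  rfl

@[simp]
lemma eps_smul_apply (x : GradedExt N) (j : ℤ) :
    ((ε : R[ε]) • x) j = (0, (x (j - 1)).1) := by
  change ((0 : R) • (show ℤ →₀ N × N from x) + (1 : R) • epsMap R N x) j = _
  rw [zero_smul, zero_add, one_smul]
  exact epsMap_apply _ j

/-- The element `(a, b)` placed in degree `j`. -/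
noncomputable def single (j : ℤ) : N × N →+ GradedExt N := Finsupp.singleAddHom j

@[simp]
lemma single_same (j : ℤ) (n : N × N) : single j n j = n := Finsupp.single_eq_same

lemma single_of_ne {i j : ℤ} (h : i ≠ j) (n : N × N) : single j n i = 0 :=
  Finsupp.single_eq_of_ne h

variable (R) in
lemma eps_smul_single (j : ℤ) (n : N × N) :
    (ε : R[ε]) • single j n = single (j + 1) (0, n.1) := by
  refine ext fun i => ?_
  rw [eps_smul_apply]
  by_cases h : i = j + 1
  · subst h
    simp
  · rw [single_of_ne h, single_of_ne (by omega)]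
    rfl

lemma inl_smul_single (r : R) (j : ℤ) (n : N × N) :
    (TrivSqZeroExt.inl r : R[ε]) • single j n = single j (r • n) := by
  refine ext fun i => ?_
  rw [inl_smul_apply]
  by_cases h : i = j
  · subst h
    simp
  · rw [single_of_ne h, single_of_ne h, smul_zero]

lemma eq_sum_single (x : GradedExt N) : ∃ s : Finset ℤ, x = ∑ i ∈ s, single i (x i) :=
  ⟨Finsupp.support x, (Finsupp.sum_single (show ℤ →₀ N × N from x)).symm⟩

/-- The component of degree `i`. -/
def component (N : Type v) [AddCommGroup N] (i : ℤ) : AddSubgroup (GradedExt N) where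
  carrier := {x | ∀ j, j ≠ i → x j = 0}
  zero_mem' _ _ := rfl
  add_mem' hx hy j hj := by rw [add_apply, hx j hj, hy j hj, add_zero]
  neg_mem' hx j hj := (congrArg Neg.neg (hx j hj)).trans neg_zero

lemma eq_single_of_mem {i : ℤ} {x : GradedExt N} (hx : x ∈ component N i) : x = single i (x i) := by
  refine ext fun j => ?_
  by_cases h : j = i
  · subst h
    simp
  · rw [hx j h, single_of_ne h]

lemma single_mem (i : ℤ) (n : N × N) : single i n ∈ component N i := fun _ h => single_of_ne h n

/-- The projection to the component of degree `i`. -/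
noncomputable def componentProj (N : Type v) [AddCommGroup N] (i : ℤ) :
    GradedExt N →+ GradedExt N :=
  (single i).comp (Finsupp.applyAddHom i : (ℤ →₀ N × N) →+ N × N)

lemma componentProj_apply (i : ℤ) (x : GradedExt N) : componentProj N i x = single i (x i) := rfl

end GradedExt

open GradedExt

/-- The graded module induced from an `R`-module `N`, in all degrees at once. -/
noncomputable abbrev gradedExt (N : ModuleCat.{v} R) : GrMod.{v} R where
  carrier := GradedExt N
  component := GradedExt.component N
  isInternal := isInternal_of_proj _ (componentProj N)
    (fun _ _ hx => (eq_single_of_mem hx).symm)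
    (fun i j x hx h => by rw [componentProj_apply, hx i h, map_zero])
    (fun i x => single_mem i _) eq_sum_single
  gradedSMul := gradedSMul_of_forall _
    (fun i r x hx j hj => by rw [inl_smul_apply, hx j hj, smul_zero])
    (fun i x hx j hj => by
      rw [eps_smul_apply, hx (j - 1) (by omega)]
      rfl)

lemma proj_gradedExt (N : ModuleCat.{v} R) (i : ℤ) (x : GradedExt N) :
    (gradedExt N).proj i x = single i (x i) :=
  proj_eq_of_forall (M := gradedExt N) i (componentProj N i)
    (fun _ hx => (eq_single_of_mem hx).symm)
    (fun _ h x hx => by rw [componentProj_apply, hx i h]; exact map_zero _) x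

/-- The functor forgetting the grading and the action of `ε`. -/
noncomputable abbrev toBase (R : Type u) [Ring R] : GrMod.{v} R ⥤ ModuleCat.{v} R :=
  forgetGrading R ⋙ restrictBase R

/-- The sum of the coefficients of `ε` in all degrees. -/
noncomputable def sumSnd (N : Type v) [AddCommGroup N] : GradedExt N →+ N :=
  (Finsupp.liftAddHom fun _ => AddMonoidHom.snd N N : (ℤ →₀ N × N) →+ N)

lemma sumSnd_single {N : Type v} [AddCommGroup N] (j : ℤ) (n : N × N) :
    sumSnd N (single j n) = n.2 :=
  Finsupp.liftAddHom_apply_single _ _ _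

/-- Additive maps on `GradedExt N` are determined on the elements of each degree. -/
lemma GradedExt.induction {N : Type v} [AddCommGroup N] {p : GradedExt N → Prop}
    (h : ∀ j n, p (single j n)) (h0 : p 0) (hadd : ∀ x y, p x → p y → p (x + y))
    (x : GradedExt N) : p x := by
  obtain ⟨s, hs⟩ := eq_sum_single x
  rw [hs]
  exact Finset.sum_induction _ p hadd h0 fun i _ => h i _

/-- The morphism `sumSnd`, which makes `gradedExt N` cofree on `N`. -/
noncomputable def gradedCounit (N : ModuleCat.{v} R) : (toBase R).obj (gradedExt N) ⟶ N :=
  restrictBaseHom (X := (gradedExt N).toMod) (sumSnd N) (fun r (x : GradedExt N) => by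
    change sumSnd N ((TrivSqZeroExt.inl r : R[ε]) • x) = r • sumSnd N x
    induction x using GradedExt.induction with
    | h j n => rw [inl_smul_single, sumSnd_single, sumSnd_single]; rfl
    | h0 => simp
    | hadd x y hx hy => rw [smul_add, map_add, map_add, smul_add, hx, hy])

/-- The function sending `j` to the image of the component of degree `j` of `x`. -/
noncomputable def projFinsupp {M : GrMod.{v} R} {Y : Type*} [AddCommGroup Y] (φ : M.carrier →+ Y)
    (x : M.carrier) : ℤ →₀ Y :=
  Finsupp.ofSupportFinite (fun j => φ (M.proj j x)) (by
    obtain ⟨s, hs, -⟩ := exists_finset_proj x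
    refine s.finite_toSet.subset fun j hj => ?_
    by_contra h
    exact hj ((congrArg φ (hs j h)).trans (map_zero φ)))

lemma isCofreeOn_gradedCounit (N : ModuleCat.{v} R) : IsCofreeOn (toBase R) (gradedCounit N) := by
  intro X f
  let φ : X.carrier →+ N :=
    { toFun := fun x => f.hom x, map_zero' := map_zero f.hom, map_add' := map_add f.hom }
  have hφ : ∀ (r : R) x, φ ((TrivSqZeroExt.inl r : R[ε]) • x) = r • φ x := fun r x =>
    map_inl_smul_of_restrictBase (X := X.toMod) f r x
  let ψ : X.carrier →+ N × N :=
    (φ.comp (DistribSMul.toAddMonoidHom X.carrier (ε : R[ε]))).prod φ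
  have hψ : ∀ x, ψ x = (φ ((ε : R[ε]) • x), φ x) := fun _ => rfl
  -- The morphism adjoint to `f` sends `x` to the family of `f (ε xⱼ) + f xⱼ ε`.
  let g : X.carrier →+ GradedExt N :=
    { toFun := fun x => projFinsupp ψ x
      map_zero' := ext fun j => by
        change ψ (X.proj j 0) = 0
        rw [map_zero, map_zero]
      map_add' := fun x y => ext fun j => by
        change ψ (X.proj j (x + y)) = ψ (X.proj j x) + ψ (X.proj j y)
        rw [map_add, map_add] }
  have hg : ∀ x j, g x j = ψ (X.proj j x) := fun _ _ => rfl
  have hgmem : ∀ i, ∀ x ∈ X.component i, g x ∈ GradedExt.component N i := fun i x hx j hj => by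
    rw [hg, proj_of_mem_of_ne hx hj, map_zero]
  let l : X.carrier →ₗ[R[ε]] GradedExt N := dualNumberLinearMap g
    (fun r x => ext fun j => by
      rw [inl_smul_apply, hg, hg, proj_inl_smul, hψ, hψ, eps_smul_inl_smul, hφ, hφ]
      rfl)
    (fun x => ext fun j => by
      have : X.proj j ((ε : R[ε]) • x) = (ε : R[ε]) • X.proj (j - 1) x := by
        rw [← proj_eps_smul, sub_add_cancel]
      rw [eps_smul_apply, hg, hg, this, hψ, hψ, eps_smul_eps_smul, map_zero])
  let G : X ⟶ gradedExt N := Hom.mk (N := gradedExt N) l hgmem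
  refine ⟨G, ?_, ?_⟩
  · ext x
    change sumSnd N (g x) = φ x
    revert x
    intro (x : X.carrier)
    induction x using component_induction with
    | h j x hx => rw [eq_single_of_mem (hgmem j x hx), sumSnd_single, hg, proj_of_mem hx, hψ]
    | h0 => simp
    | hadd x y hx hy => rw [map_add, map_add, map_add, hx, hy]
  · intro h hh
    let h' : X.carrier →ₗ[R[ε]] GradedExt N := h.toLinearMap
    have hh' : ∀ x, sumSnd N (h' x) = φ x := fun x =>
      LinearMap.congr_fun (congrArg ModuleCat.Hom.hom hh) x
    have h₂ : ∀ x j, (h' x j).2 = φ (X.proj j x) := fun x j => by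
      rw [← hh', ← sumSnd_single j (h' x j), ← proj_gradedExt N j (h' x)]
      exact congrArg (sumSnd N) (map_proj h j x).symm
    have h₁ : ∀ x j, (h' x j).1 = φ ((ε : R[ε]) • X.proj j x) := fun x j => by
      rw [← proj_eps_smul, ← h₂, map_smul, eps_smul_apply, add_sub_cancel_right]
    exact hom_ext fun x => ext fun j => Prod.ext (h₁ x j) (h₂ x j)

/-- The graded map from `gradedExt N` that sends `a` in degree `j` to the component of degree `j`
of `b j a`. -/
noncomputable def fromGradedExt {X : GrMod.{v} R} {N : ModuleCat.{v} R}
    (b : ℤ → (N ⟶ (toBase R).obj X)) : gradedExt N ⟶ X := by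
  let β : ℤ → N →+ X.carrier := fun j =>
    (X.proj j).comp
      { toFun := fun n => (b j).hom n
        map_zero' := map_zero (b j).hom
        map_add' := map_add (b j).hom }
  have hβ : ∀ j (r : R) n, β j (r • n) = (TrivSqZeroExt.inl r : R[ε]) • β j n := fun j r n => by
    refine (congrArg (X.proj j) ?_).trans (proj_inl_smul j r _)
    exact map_smul_of_to_restrictBase (X := X.toMod) (b j) r n
  have hβmem : ∀ j n, β j n ∈ X.component j := fun j n => X.proj_mem j _
  let g : GradedExt N →+ X.carrier :=
    (Finsupp.liftAddHom fun j => (β j).coprod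
      ((DistribSMul.toAddMonoidHom X.carrier (ε : R[ε])).comp (β (j - 1))) :
      (ℤ →₀ N × N) →+ X.carrier)
  have hg : ∀ j n, g (single j n) = β j n.1 + (ε : R[ε]) • β (j - 1) n.2 := fun j n =>
    Finsupp.liftAddHom_apply_single _ _ _
  refine Hom.mk (M := gradedExt N) (dualNumberLinearMap (X := GradedExt N) g
    (fun r x => ?_) (fun x => ?_)) (fun i x hx => ?_)
  · induction x using GradedExt.induction with
    | h j n =>
      rw [inl_smul_single, hg, hg, smul_add, ← eps_smul_inl_smul, ← hβ, ← hβ]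
      rfl
    | h0 => simp
    | hadd x y hx hy => rw [smul_add, map_add, map_add, hx, hy, smul_add]
  · induction x using GradedExt.induction with
    | h j n =>
      rw [eps_smul_single, hg, hg, map_zero, zero_add, smul_add, eps_smul_eps_smul, add_zero,
        add_sub_cancel_right]
    | h0 => simp
    | hadd x y hx hy => rw [smul_add, map_add, map_add, hx, hy, smul_add]
  · change g x ∈ X.component i
    rw [eq_single_of_mem hx, hg]
    refine add_mem (hβmem _ _) ?_
    have := eps_smul_mem (hβmem (i - 1) (x i).2)
    rwa [sub_add_cancel] at this

lemma fromGradedExt_single {X : GrMod.{v} R} {N : ModuleCat.{v} R}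
    (b : ℤ → (N ⟶ (toBase R).obj X)) (j : ℤ) (n : N) :
    (fromGradedExt b).toLinearMap (single j (n, 0)) = X.proj j ((b j).hom n : X.carrier) := by
  refine (Finsupp.liftAddHom_apply_single _ _ _).trans ?_
  change X.proj j ((b j).hom n) + (ε : R[ε]) • X.proj (j - 1) ((b (j - 1)).hom 0) = _
  rw [map_zero]
  change _ + (ε : R[ε]) • X.proj (j - 1) 0 = _
  rw [map_zero, smul_zero, add_zero]

lemma gradedExt_hom_ext {X : GrMod.{v} R} {N : ModuleCat.{v} R} {f g : gradedExt N ⟶ X}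
    (h : ∀ j (n : N), f.toLinearMap (single j (n, 0)) = g.toLinearMap (single j (n, 0))) :
    f = g := by
  refine hom_ext fun x => ?_
  induction x using GradedExt.induction with
  | h j n =>
    have hn : single j n = single j (n.1, 0) + (ε : R[ε]) • single (j - 1) (n.2, (0 : N)) := by
      rw [eps_smul_single, sub_add_cancel, ← map_add]
      simp
    rw [hn, map_add, map_add, map_smul, map_smul, h, h]
  | h0 => rw [map_zero, map_zero]
  | hadd x y hx hy => rw [map_add, map_add, hx, hy]

lemma projective_gradedExt (N : ModuleCat.{v} R) (hN : Projective N) :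
    Projective (gradedExt N) where
  factors {Y Z} f p hp := by
    have : Epi ((toBase R).map p) := (ModuleCat.epi_iff_surjective _).2 (surjective_of_epi p)
    let a : ℤ → (N ⟶ (toBase R).obj Z) := fun j =>
      homRestrictBase (X := Z.toMod) (f.toLinearMap.toAddMonoidHom.comp
        ((single j).comp (AddMonoidHom.inl N N))) (fun r n => by
          have h : (single j (r • n, 0) : GradedExt N) =
              (TrivSqZeroExt.inl r : R[ε]) • single j (n, 0) := by
            rw [inl_smul_single, Prod.smul_mk, smul_zero]
          exact (congrArg f.toLinearMap h).trans (map_smul f.toLinearMap _ _))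
    refine ⟨fromGradedExt fun j => Projective.factorThru (a j) ((toBase R).map p),
      gradedExt_hom_ext fun j n => ?_⟩
    rw [comp_toLinearMap, LinearMap.comp_apply, fromGradedExt_single]
    refine (map_proj p j _).trans ?_
    have h := LinearMap.congr_fun (congrArg ModuleCat.Hom.hom
      (Projective.factorThru_comp (a j) ((toBase R).map p))) n
    refine (congrArg (Z.proj j) h).trans (proj_of_mem ?_)
    exact f.map_mem j _ (single_mem (N := N) j (n, 0))

/-- Every graded module `X` is a quotient of the graded module induced from a projective `R`-module,
namely one that maps onto `X`. -/
lemma exists_epi_gradedExt (X : GrMod.{max u v} R) :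
    ∃ N : ModuleCat.{max u v} R, Projective N ∧ ∃ p : gradedExt N ⟶ X, Epi p := by
  let p : Projective.over ((toBase R).obj X) ⟶ (toBase R).obj X := Projective.π _
  have hp : Function.Surjective p.hom := (ModuleCat.epi_iff_surjective p).1 inferInstance
  refine ⟨_, inferInstance, fromGradedExt fun _ => p, epi_of_surjective _ fun x => ?_⟩
  induction x using component_induction with
  | h j x hx =>
    obtain ⟨n, hn⟩ := hp x
    exact ⟨_, (fromGradedExt_single (fun _ => p) j n).trans
      ((congrArg (X.proj j) hn).trans (proj_of_mem hx))⟩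
  | h0 => exact ⟨0, map_zero _⟩
  | hadd x y hx hy =>
    obtain ⟨a, rfl⟩ := hx
    obtain ⟨b, rfl⟩ := hy
    exact ⟨a + b, map_add _ _ _⟩

instance : EnoughProjectives (GrMod.{max u v} R) where
  presentation X := by
    obtain ⟨N, hN, p, hp⟩ := exists_epi_gradedExt X
    exact ⟨{ p := gradedExt N, projective := projective_gradedExt N hN, f := p }⟩

lemma projective_toBase_gradedExt (N : ModuleCat.{max u v} R) (hN : Projective N) :
    Projective ((toBase R).obj (gradedExt N)) := by
  classical
  have : Module.Projective R N := (IsProjective.iff_projective _).2 hN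
  have : Module.Projective R (ℤ →₀ N × N) :=
    Module.Projective.of_equiv (finsuppLequivDFinsupp (ι := ℤ) (M := N × N) R).symm
  exact projective_restrictBase_obj (X := (gradedExt N).toMod) (P := ℤ →₀ N × N)
    (AddEquiv.refl (ℤ →₀ N × N)) fun r (x : GradedExt N) =>
      ext (x := (show GradedExt N from r • (show ℤ →₀ N × N from x))) fun j =>
        (inl_smul_apply r x j).symm

/-- Forgetting the grading and the action of `ε` is Frobenius-like. The product of the shifts of
the coinduced graded module agrees with their direct sum `gradedExt`, since in each degree only two
of them are non-zero. -/
lemma isFrobeniusLike_toBase (R : Type u) [Ring R] : IsFrobeniusLike (toBase.{max u v} R) := by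
  have hretract : ∀ Q : GrMod.{max u v} R, Projective Q → ∃ N : ModuleCat.{max u v} R,
      Projective N ∧ Nonempty (Retract Q (gradedExt N)) := fun Q hQ => by
    obtain ⟨N, hN, p, hp⟩ := exists_epi_gradedExt Q
    exact ⟨N, hN, ⟨⟨Projective.factorThru (𝟙 Q) p, p, Projective.factorThru_comp _ _⟩⟩⟩
  refine ⟨fun T hT => shortExact_restrictBase _ (shortExact_forgetGrading T hT), fun Q hQ => ?_,
    fun N hN => ⟨_, gradedCounit N, projective_gradedExt N hN, isCofreeOn_gradedCounit N⟩,
    fun Q hQ => ?_⟩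
  · obtain ⟨N, hN, ⟨r⟩⟩ := hretract Q hQ
    have := projective_toBase_gradedExt N hN
    exact (r.map (toBase R)).projective
  · obtain ⟨N, hN, h⟩ := hretract Q hQ
    exact ⟨N, _, gradedCounit N, hN, isCofreeOn_gradedCounit N, h⟩

end GrMod

theorem theorem3p1 {R : Type u} [Ring R] (M : GrMod.{max u v} R) :
    List.TFAE [
      IsGorensteinProjective M,
      IsGorensteinProjective M.toMod,
      IsGorensteinProjective M.toBaseMod] := by
  have h₁ := (GrMod.isFrobeniusLike_toBase.{v} R).isGorensteinProjective_iff M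
  have h₂ := (isFrobeniusLike_restrictBase.{v} R).isGorensteinProjective_iff M.toMod
  tfae_have 1 ↔ 3 := h₁
  tfae_have 2 ↔ 3 := h₂
  tfae_finish
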